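/- Let $n\ge 0$, let $F_n$ be the free group of rank $n$, let $p$ be a prime, and let $\mathcal K$ be an exhausting system of finite characteristic $p$-covers of $F_n$, i.e. a set of characteristic subgroups of $F_n$ of finite $p$-power index such that every normal subgroup of $p$-power index contains a member of $\mathcal K$. Let $$H(F_n)=\varprojlim_{N\in\mathcal K} H_1(N;\mathbb C),\qquad H_1(N;\mathbb C)=N^{\mathrm{ab}}\otimes_{\mathbb Z}\mathbb C,$$ where the transition maps are induced by inclusions. $\mathrm{Aut}(F_n)$ acts on $H(F_n)$ by restriction to the subgroups $N\in\mathcal K$, and $F_n$ acts on it through conjugation (on $H_1(N;\mathbb C)$ this is the action of the deck group $F_n/N$). A deck character is a function $\chi:F_n\to\mathbb C$ that is the character of an irreducible finite-dimensional complex representation of a deck group $F_n/N$, $N\in\mathcal K$ (viewed as a representation of $F_n$), which embeds $F_n$-equivariantly into $H(F_n)$. An automorphism $\psi$ of $F_n$ (or its outer class) is reducible if there are a finite connected graph $\Gamma$ without vertices of valence one, an identification $\pi_1(\Gamma)\cong F_n$, a map $f:\Gamma\to\Gamma$, sending vertices to vertices and edges to edge paths, that represents the outer class of $\psi$, and a proper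 subgraph $\Gamma_0\subset\Gamma$ which is not a forest and which $f$ maps into itself, where the image of an edge is considered up to homotopy relative to its end points. Otherwise $\psi$ is irreducible. Then $H(F_n)$ detects finite order automorphisms and irreducible automorphisms: for every $\psi\in\mathrm{Aut}(F_n)$, 1. $\psi$ has finite order in $\mathrm{Aut}(F_n)$ if and only if $\psi$ acts on $H(F_n)$ with finite order. 2. $\psi$ has finite order in $\mathrm{Out}(F_n)$ if and only if there is an $m\ge 1$ such that $\chi\circ\psi^m=\chi$ for every deck character $\chi$. Moreover, if $n\ge 2$, then for every $m\ge 0$ the automorphism $\psi^m$ is inner if and only if $\chi\circ\psi^m=\chi$ for every deck character $\chi$. 3. $\psi$ is irreducible if and only if for every $k\ge 0$ and all nontrivial proper subgroups $A_0,\dots,A_k$ of $F_n$ whose internal free product $A_0*\cdots*A_k$ is a free factor of $F_n$ there are $i\in\{0,\dots,k\}$ and $a\in A_i$ such that for every $a'\in A_{i+1}$ (indices modulo $k+1$) there is a deck character $\chi$ with $\chi(\psi(a))\neq\chi(a')$. -/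

import Mathlib

noncomputable section

open scoped TensorProduct

namespace FreeGroupDetection

/-! ### First complex homology of groups and its functoriality -/

/-- `H₁(N; ℂ)`: the abelianization of `N`, tensored with `ℂ`. -/
abbrev H1 (N : Type) [Group N] : Type := ℂ ⊗[ℤ] Additive (Abelianization N)

/-- The linear map induced on `H₁(-; ℂ)` by a group homomorphism. -/
def H1.map {N M : Type} [Group N] [Group M] (f : N →* M) : H1 N →ₗ[ℂ] H1 M :=
  LinearMap.baseChange ℂ (MonoidHom.toAdditive (Abelianization.map f)).toIntLinearMap

theorem H1.map_id (N : Type) [Group N] : H1.map (MonoidHom.id N) = LinearMap.id := by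
  unfold H1.map
  rw [Abelianization.map_id]
  exact LinearMap.baseChange_id

theorem H1.map_comp {N M L : Type} [Group N] [Group M] [Group L] (g : M →* L) (f : N →* M) :
    H1.map (g.comp f) = (H1.map g).comp (H1.map f) := by
  unfold H1.map
  rw [← Abelianization.map_comp, ← LinearMap.baseChange_comp]
  rfl

/-- The restriction of an automorphism of `G` to a characteristic subgroup. -/
def restrictAut {G : Type} [Group G] (N : Subgroup G) (hN : N.Characteristic) (φ : MulAut G) :
    N →* N :=
  (φ.toMonoidHom.comp N.subtype).codRestrict N fun x =>
    (Subgroup.characteristic_iff_le_comap.mp hN φ) x.2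

/-! ### Exhausting systems of characteristic `p`-covers and pro-`p` homology -/

/-- An exhausting system of finite characteristic `p`-covers of `G`: a collection of characteristic
subgroups of finite `p`-power index that is cofinal among the normal subgroups of `p`-power index,
i.e. every finite `p`-group quotient of `G` is a quotient of one of the deck groups `G ⧸ N`. -/
structure PCoverSystem (G : Type) [Group G] (p : ℕ) where
  /-- The subgroups of the system. -/
  carrier : Set (Subgroup G)
  characteristic : ∀ N ∈ carrier, N.Characteristic
  index_eq : ∀ N ∈ carrier, ∃ k : ℕ, N.index = p ^ k
  exhausting : ∀ M : Subgroup G, M.Normal → (∃ k : ℕ, M.index = p ^ k) → ∃ N ∈ carrier, N ≤ M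

section ProHomology

variable {G : Type} [Group G] {p : ℕ}

/-- The pro-`p` complex homology `lim H₁(N; ℂ)`: compatible families of homology classes, where
`N` ranges over the system and the transition maps are induced by inclusions `N ≤ M`. -/
def ProH (K : PCoverSystem G p) : Submodule ℂ ((N : K.carrier) → H1 (N : Subgroup G)) where
  carrier := {x | ∀ (N M : K.carrier) (h : (N : Subgroup G) ≤ (M : Subgroup G)),
    H1.map (Subgroup.inclusion h) (x N) = x M}
  add_mem' := by
    intro x y hx hy N M h
    simp [hx N M h, hy N M h]
  zero_mem' := by
    intro N M h
    simp
  smul_mem' := by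
    intro c x hx N M h
    simp [hx N M h]

/-- The action of `Aut(G)` on the pro-`p` homology: `φ` acts on the `N`-component by the map
induced by its restriction to the characteristic subgroup `N`. -/
def autRep (K : PCoverSystem G p) : Representation ℂ (MulAut G) (ProH K) where
  toFun φ :=
    { toFun := fun x => ⟨fun N => H1.map (restrictAut N.1 (K.characteristic N.1 N.2) φ) (x.1 N), by
        intro N M h
        change H1.map (Subgroup.inclusion h) (H1.map (restrictAut N.1 _ φ) (x.1 N)) =
          H1.map (restrictAut M.1 _ φ) (x.1 M)
        rw [← x.2 N M h, ← LinearMap.comp_apply, ← LinearMap.comp_apply, ← H1.map_comp,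
          ← H1.map_comp]
        rfl⟩
      map_add' := by
        intro x y
        ext N
        simp
      map_smul' := by
        intro c x
        ext N
        simp }
  map_one' := by
    ext x N
    exact congrArg (fun f => f (x.1 N)) (H1.map_id N.1)
  map_mul' := by
    intro φ ψ
    ext x N
    exact congrArg (fun f => f (x.1 N))
      (H1.map_comp (restrictAut N.1 (K.characteristic N.1 N.2) φ)
        (restrictAut N.1 (K.characteristic N.1 N.2) ψ))

/-- The action of `G` on the pro-`p` homology by conjugation; on the `N`-component it is the
action of the deck group `G ⧸ N` on `H₁(N; ℂ)`. -/
def deckRep (K : PCoverSystem G p) : Representation ℂ G (ProH K) :=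
  (autRep K).comp MulAut.conj

/-- `χ : G → ℂ` is a *deck character* of the pro-`p` homology if it is the character of an
irreducible representation `ρ` of a deck group `G ⧸ N`, with `N` in the system (regarded as a
representation of `G` on which `N` acts trivially), which occurs in the pro-`p` homology, that is,
embeds `G`-equivariantly into it. -/
def IsDeckCharacter (K : PCoverSystem G p) (χ : G → ℂ) : Prop :=
  ∃ (V : Type) (_ : AddCommGroup V) (_ : Module ℂ V) (_ : FiniteDimensional ℂ V)
    (ρ : Representation ℂ G V) (ι : V →ₗ[ℂ] ProH K),
    ρ.IsIrreducible ∧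
    (∃ N ∈ K.carrier, ∀ g ∈ N, ρ g = 1) ∧
    Function.Injective ι ∧
    (∀ g v, ι (ρ g v) = deckRep K g (ι v)) ∧
    χ = ρ.character

end ProHomology

/-! ### Outer automorphisms, free factors -/

instance innerNormal (G : Type) [Group G] : (MulAut.conj (G := G)).range.Normal where
  conj_mem := by
    rintro _ ⟨g, rfl⟩ φ
    exact ⟨φ g, by ext x; simp [MulAut.conj_apply]⟩

/-- The outer automorphism group `Out(G) = Aut(G) / Inn(G)`. -/
abbrev Out (G : Type) [Group G] : Type := MulAut G ⧸ (MulAut.conj (G := G)).range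

/-- The subgroups `A 0, …, A k` of `G` are nontrivial and proper, and `A 0 * ⋯ * A k` is (an
internal free product and) a free factor of `G`: for some subgroup `B`, the canonical map from the
free product of `A 0, …, A k` and `B` to `G` is an isomorphism. -/
def IsFreeFactorSystem {G : Type} [Group G] {k : ℕ} (A : Fin (k + 1) → Subgroup G) : Prop :=
  (∀ i, A i ≠ ⊥ ∧ A i ≠ ⊤) ∧
  ∃ B : Subgroup G, Function.Bijective
    (Monoid.Coprod.lift (Monoid.CoprodI.lift fun i => (A i).subtype) B.subtype)

/-! ### Reducible automorphisms -/

/-- The arrows of the fundamental groupoid of the graph `V` which are the single edges belonging to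
a set `S` of edges. -/
inductive IsEdgeOf {V : Type} [Quiver.{1} V] (S : ∀ a b : V, Set (a ⟶ b)) :
    ∀ x y : Quiver.FreeGroupoid V, (x ⟶ y) → Prop
  | edge {a b : V} (e : a ⟶ b) (he : e ∈ S a b) :
      IsEdgeOf S ((Quiver.FreeGroupoid.of V).obj a) ((Quiver.FreeGroupoid.of V).obj b)
        ((Quiver.FreeGroupoid.of V).map e)

/-- The fundamental groupoid of the subgraph with edge set `S` inside that of the graph `V`: the
homotopy classes of (nonempty) edge paths all of whose edges are in `S`. -/
def edgeGroupoid {V : Type} [Quiver.{1} V] (S : ∀ a b : V, Set (a ⟶ b)) :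
    CategoryTheory.Subgroupoid (Quiver.FreeGroupoid V) :=
  CategoryTheory.Subgroupoid.generated fun x y => {q | IsEdgeOf S x y q}

open CategoryTheory in
/-- An automorphism `ψ` of the free group of rank `n` (equivalently its outer class) is *reducible*
if it is represented by a self-map of a marked graph which maps a proper subgraph that is not a
forest into itself.

A finite graph is a finite quiver `V` (arbitrarily oriented edges), assumed connected and without
vertices of valence one (a loop counts twice); its fundamental groupoid is the free groupoid on
`V`. The marking is an isomorphism of `F_n` with the vertex group at a base vertex `v`. A map `f`
sending vertices to vertices and edges to edge paths, up to homotopy of these paths relative to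
their end points, is a functor of fundamental groupoids. It represents the outer class of `ψ` if
along some path `γ` from `v` to `f v` it induces `ψ`. The subgraph is given by its set `S` of
edges: properness says that some edge is missing, not being a forest says that some closed edge
path in the subgraph is not null-homotopic, and invariance says that `f` maps every edge in `S` to
a path which is homotopic, relative to its end points, to an edge path in the subgraph. -/
def IsReducible {n : ℕ} (ψ : MulAut (FreeGroup (Fin n))) : Prop :=
  ∃ (V : Type) (_ : Quiver.{1} V) (_ : Finite V) (_ : ∀ a b : V, Finite (a ⟶ b))
    (v : Quiver.FreeGroupoid V) (m : FreeGroup (Fin n) ≃* (v ⟶ v))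
    (f : Quiver.FreeGroupoid V ⥤ Quiver.FreeGroupoid V) (γ : v ⟶ f.obj v)
    (S : ∀ a b : V, Set (a ⟶ b)),
    (∀ a b : Quiver.FreeGroupoid V, Nonempty (a ⟶ b)) ∧
    (∀ a : V, Nat.card ((Σ b, (a ⟶ b)) ⊕ (Σ b, (b ⟶ a))) ≠ 1) ∧
    (∀ w : FreeGroup (Fin n), m (ψ w) = γ ≫ f.map (m w) ≫ Groupoid.inv γ) ∧
    (∃ (a b : V) (e : a ⟶ b), e ∉ S a b) ∧
    (∃ (x : Quiver.FreeGroupoid V) (q : x ⟶ x), q ∈ (edgeGroupoid S).arrows x x ∧ q ≠ 𝟙 x) ∧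
    (∀ (a b : V) (e : a ⟶ b), e ∈ S a b →
      f.map ((Quiver.FreeGroupoid.of V).map e) ∈ (edgeGroupoid S).arrows _ _)

/-- An automorphism is *irreducible* if it is not reducible. -/
def IsIrreducible {n : ℕ} (ψ : MulAut (FreeGroup (Fin n))) : Prop := ¬ IsReducible ψ

end FreeGroupDetection

end

namespace FreeGroupDetection

/-! ### Free groups are conjugacy `p`-separable -/

section ConjugacySeparability

open FreeGroup hiding map_mul map_one map_inv norm_mul_le

/-! In rank at least two everything rests on one fact: deck characters separate the conjugacy
classes of `F_n` (`isConj_iff_deckCharacter`). Free groups are conjugacy `p`-separable, so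
nonconjugate elements stay nonconjugate in some deck group (`exists_pGroup_not_isConj`), and the
irreducible characters of a finite group separate its classes (`exists_irreducible_character_ne`).
Moreover every irreducible representation `V` of a deck group `F_n/N` occurs in the pro-`p`
homology. Derivations `F_n → V` form a space of dimension `n * dim V`, the inner ones one of
dimension at most `dim V`, and a derivation vanishing on `N` is inner; hence some derivation
restricts to a nonzero equivariant map `H₁(N; ℂ) → V` (`exists_surjective_conjRep`). By Maschke's
theorem this map and all transition maps split, so `V` embeds into the limit
(`exists_proH_section`).

Finite order: an automorphism acting trivially on the homology has `φ(g) g⁻¹` acting trivially in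
every deck representation, so it is the identity. An automorphism fixing all deck characters
preserves every conjugacy class, and such automorphisms are inner
(`exists_conj_of_pointwise_inner`).

Irreducibility: `ψ` is reducible exactly when some free factor system `A₀, …, A_k` is permuted
cyclically in the sense that every element of `ψ(A_i)` is conjugate into `A_{i+1}`
(`isReducible_iff`), a condition that deck characters can express. From such a system, elementwise
conjugacy is upgraded to one conjugator per factor (`exists_conj_le_letterSubgroup`) and a map of a
star-shaped graph realizes `ψ`. Conversely, the components with nontrivial fundamental group of an
invariant subgraph contain a cycle under the graph map, and a spanning tree adapted to these
components exhibits their fundamental groups as free factors (`exists_freeFactor_paths`). -/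

theorem hom_eq_of_forall_mem_toWord {α H : Type} [DecidableEq α] [Group H] (f g : FreeGroup α →* H)
    (u : FreeGroup α) (h : ∀ a ∈ u.toWord, f (of a.1) = g (of a.1)) : f u = g u := by
  have key : ∀ L : List (α × Bool), (∀ a ∈ L, f (of a.1) = g (of a.1)) →
      f (FreeGroup.mk L) = g (FreeGroup.mk L) := by
    intro L
    induction L with
    | nil => intro _; simp [← one_eq_mk]
    | cons a L ih =>
      intro h
      have h1 : FreeGroup.mk (a :: L) = FreeGroup.mk [a] * FreeGroup.mk L := by simp [mul_mk]
      have h2 : f (FreeGroup.mk [a]) = g (FreeGroup.mk [a]) := by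
        obtain ⟨a, b⟩ := a
        have h3 := h (a, b) (by simp)
        cases b
        · have : FreeGroup.mk [(a, false)] = (of a)⁻¹ := by simp [of, inv_mk, invRev]
          rw [this, map_inv, map_inv]; exact congrArg _ h3
        · exact h3
      rw [h1, map_mul, map_mul, h2, ih fun b hb => h b (List.mem_cons_of_mem _ hb)]
  rw [← mk_toWord (x := u)]
  exact key _ h

/-- The exponent sum of the letter `a`. -/
def expSum {α : Type} [DecidableEq α] (a : α) : FreeGroup α →* Multiplicative ℤ :=
  FreeGroup.lift fun b => if b = a then Multiplicative.ofAdd 1 else 1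

theorem isPGroup_of_card_zmod {p k : ℕ} [Fact p.Prime] :
    IsPGroup p (Multiplicative (ZMod (p ^ k))) :=
  IsPGroup.of_card (n := k) (by simp)

/-- The reduction of integers modulo `m`, multiplicatively. -/
def redMod (m : ℕ) : Multiplicative ℤ →* Multiplicative (ZMod m) :=
  AddMonoidHom.toMultiplicative (Int.castAddHom (ZMod m))

/-- Reduction modulo a power of `p` larger than the difference keeps the exponent sums distinct, and
in an abelian quotient conjugate elements are equal. -/
theorem separate_of_expSum_ne {α : Type} [DecidableEq α] {p : ℕ} [hp : Fact p.Prime]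
    {u v : FreeGroup α} {a : α} (h : expSum a u ≠ expSum a v) :
    ∃ (Q : Type) (_ : Group Q) (_ : Finite Q) (_ : IsPGroup p Q) (f : FreeGroup α →* Q),
      ¬ IsConj (f u) (f v) := by
  set d : ℤ := Multiplicative.toAdd (expSum a u) - Multiplicative.toAdd (expSum a v) with hd
  have hd0 : d ≠ 0 := fun h0 => h (Multiplicative.toAdd.injective (sub_eq_zero.mp h0))
  obtain ⟨k, hk⟩ : ∃ k : ℕ, d.natAbs < p ^ k :=
    ⟨_, Nat.lt_pow_self hp.out.one_lt⟩
  have : NeZero (p ^ k) := ⟨pow_ne_zero _ hp.out.ne_zero⟩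
  refine ⟨Multiplicative (ZMod (p ^ k)), inferInstance, inferInstance, isPGroup_of_card_zmod,
    (redMod (p ^ k)).comp (expSum a), fun hc => ?_⟩
  rw [isConj_iff_eq] at hc
  have h1 : ((Multiplicative.toAdd (expSum a u) : ℤ) : ZMod (p ^ k)) =
    ((Multiplicative.toAdd (expSum a v) : ℤ) : ZMod (p ^ k)) := hc
  have h2 : ((d : ℤ) : ZMod (p ^ k)) = 0 := by rw [hd, Int.cast_sub, h1, sub_self]
  rw [ZMod.intCast_zmod_eq_zero_iff_dvd] at h2
  have h3 := Int.natAbs_dvd_natAbs.mpr h2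
  rw [Int.natAbs_natCast] at h3
  exact absurd (Nat.le_of_dvd (Int.natAbs_pos.mpr hd0) h3) (by omega)

theorem expSum_of_self {α : Type} [DecidableEq α] (a : α) :
    expSum a (of a) = Multiplicative.ofAdd 1 := by simp [expSum]

theorem expSum_of_ne {α : Type} [DecidableEq α] {a b : α} (h : b ≠ a) :
    expSum a (of b) = 1 := by simp [expSum, h]

/-- If `u` and `v` have the same exponent sums and are different, then some homomorphism to `ℤ/p`
kills both and sends a letter occurring in one of them to the generator. -/
theorem exists_character_mod_p {α : Type} [DecidableEq α] {p : ℕ} [hp : Fact p.Prime]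
    {u v : FreeGroup α} (huv : u ≠ v) (h : ∀ a, expSum a u = expSum a v) :
    ∃ (θ : FreeGroup α →* Multiplicative (ZMod p)) (x : α),
      θ u = 1 ∧ θ v = 1 ∧ θ (of x) = Multiplicative.ofAdd 1 ∧
      ((∃ b, (x, b) ∈ u.toWord) ∨ (∃ b, (x, b) ∈ v.toWord)) := by
  set Lt : α → Prop := fun x => (∃ b, (x, b) ∈ u.toWord) ∨ (∃ b, (x, b) ∈ v.toWord) with hLt
  -- A nonzero value at `x` can be rescaled to `1` because `ℤ/p` is a field.
  suffices H : ∃ (θ : FreeGroup α →* Multiplicative (ZMod p)) (x : α),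
      θ u = 1 ∧ θ v = 1 ∧ θ (of x) ≠ 1 ∧ Lt x by
    obtain ⟨θ, x, hu, hv, hx, hl⟩ := H
    set c : ZMod p := Multiplicative.toAdd (θ (of x)) with hc
    have hc0 : c ≠ 0 := fun h0 => hx (Multiplicative.toAdd.injective h0)
    refine ⟨(AddMonoidHom.toMultiplicative (AddMonoidHom.mulLeft c⁻¹)).comp θ, x, ?_, ?_, ?_, hl⟩
    · simp [hu]
    · simp [hv]
    · change Multiplicative.ofAdd (c⁻¹ * c) = _
      rw [inv_mul_cancel₀ hc0]
  let e : α → FreeGroup α →* Multiplicative (ZMod p) := fun a => (redMod p).comp (expSum a)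
  have he : ∀ a, e a u = e a v := fun a => congrArg (redMod p) (h a)
  have hee : ∀ a, e a (of a) = Multiplicative.ofAdd 1 := fun a => by
    change redMod p (expSum a (of a)) = _
    rw [expSum_of_self]
    change Multiplicative.ofAdd (((1 : ℤ) : ZMod p)) = _
    simp
  have hen : ∀ a b, b ≠ a → e a (of b) = 1 := fun a b hab => by
    change redMod p (expSum a (of b)) = _
    rw [expSum_of_ne hab, map_one]
  have h1 : (Multiplicative.ofAdd 1 : Multiplicative (ZMod p)) ≠ 1 := by
    intro h0
    exact one_ne_zero (α := ZMod p) (Multiplicative.ofAdd.injective h0)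
  by_cases hA : ∃ x, Lt x ∧ e x u = 1
  · obtain ⟨x, hx, hxu⟩ := hA
    exact ⟨e x, x, hxu, he x ▸ hxu, by rw [hee]; exact h1, hx⟩
  push Not at hA
  by_cases hB : ∃ x y, Lt x ∧ Lt y ∧ x ≠ y
  · obtain ⟨x, y, hx, hy, hxy⟩ := hB
    let cx : ZMod p := Multiplicative.toAdd (e x u)
    let cy : ZMod p := Multiplicative.toAdd (e y u)
    let θ : FreeGroup α →* Multiplicative (ZMod p) :=
      (AddMonoidHom.toMultiplicative (AddMonoidHom.mulLeft cy)).comp (e x) *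
      ((AddMonoidHom.toMultiplicative (AddMonoidHom.mulLeft cx)).comp (e y))⁻¹
    have hθ : ∀ w, θ w = Multiplicative.ofAdd (cy * Multiplicative.toAdd (e x w) +
      -(cx * Multiplicative.toAdd (e y w))) := fun w => rfl
    refine ⟨θ, x, ?_, ?_, ?_, hx⟩
    · rw [hθ, ← ofAdd_zero]
      congr 1
      change cy * cx + -(cx * cy) = 0
      ring
    · rw [hθ, ← he, ← he, ← ofAdd_zero]
      congr 1
      change cy * cx + -(cx * cy) = 0
      ring
    · rw [hθ, hee, hen y x hxy]
      intro h0
      have h2 : cy * 1 + -(cx * 0) = 0 := Multiplicative.ofAdd.injective h0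
      rw [mul_one, mul_zero, neg_zero, add_zero] at h2
      exact hA y hy (Multiplicative.toAdd.injective h2)
  push Not at hB
  exfalso
  apply huv
  by_cases hC : ∃ x, Lt x
  · obtain ⟨x, hx⟩ := hC
    have key : ∀ w : FreeGroup α, (∀ b ∈ w.toWord, Lt b.1) →
        (zpowersHom (FreeGroup α) (of x)).comp (expSum x) w = w := by
      intro w hw
      refine hom_eq_of_forall_mem_toWord _ (MonoidHom.id _) w fun b hb => ?_
      have : b.1 = x := (hB _ _ hx (hw b hb)).symm
      rw [this]
      simp [expSum_of_self, zpowersHom]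
    rw [← key u fun b hb => Or.inl ⟨b.2, hb⟩, ← key v fun b hb => Or.inr ⟨b.2, hb⟩]
    simp only [MonoidHom.comp_apply, h]
  · push Not at hC
    have key : ∀ w : FreeGroup α, (∀ b ∈ w.toWord, Lt b.1) → w = 1 := by
      intro w hw
      rw [← toWord_eq_nil_iff, List.eq_nil_iff_forall_not_mem]
      exact fun b hb => hC b.1 (hw b hb)
    rw [key u fun b hb => Or.inl ⟨b.2, hb⟩, key v fun b hb => Or.inr ⟨b.2, hb⟩]

/-! ### The cyclic `p`-fold cover as a homomorphism to a wreath product -/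

section Wreath

open RegularWreathProduct

variable {α : Type} [DecidableEq α] {p : ℕ} [hp : Fact p.Prime]
  (θ : FreeGroup α →* Multiplicative (ZMod p)) (x : α)

/-- The label of the edge over the letter `y` starting at `j` in the cyclic cover given by `θ`,
where all edges over `x` but the last one are collapsed. -/
def edgeLabel (j : Multiplicative (ZMod p)) (y : α) : FreeGroup (Multiplicative (ZMod p) × α) :=
  if y = x ∧ j ≠ Multiplicative.ofAdd (-1) then 1 else of (j, y)

/-- Reading words along the cyclic cover given by `θ`. -/
def coverHom : FreeGroup α →*
    FreeGroup (Multiplicative (ZMod p) × α) ≀ᵣ Multiplicative (ZMod p) :=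
  FreeGroup.lift fun y => ⟨fun j => edgeLabel x j y, (θ (of y))⁻¹⟩

/-- The top component is inverted so that, in a product `v * w`, the word `w` is read from `θ v *
j`, the end point of the lift of `v` starting at `j`. -/
theorem coverHom_right (w : FreeGroup α) : (coverHom θ x w).right = (θ w)⁻¹ := by
  have : rightHom.comp (coverHom θ x) = θ⁻¹ := by
    ext y
    simp [coverHom]
  exact DFunLike.congr_fun this w

theorem coverHom_mul_left (v w : FreeGroup α) (j : Multiplicative (ZMod p)) :
    (coverHom θ x (v * w)).left j = (coverHom θ x v).left j * (coverHom θ x w).left (θ v * j) := by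
  rw [map_mul, mul_left]
  simp [coverHom_right]

theorem coverHom_inv_left (w : FreeGroup α) (j : Multiplicative (ZMod p)) :
    (coverHom θ x w⁻¹).left j = ((coverHom θ x w).left ((θ w)⁻¹ * j))⁻¹ := by
  rw [map_inv, inv_left]
  simp [coverHom_right]

theorem coverHom_of_left (y : α) (j : Multiplicative (ZMod p)) :
    (coverHom θ x (of y)).left j = edgeLabel x j y := by
  simp [coverHom]

/-- The homomorphism sending an edge of the cyclic cover to the loop in the base given by the
collapsed tree. -/
def coverBack : FreeGroup (Multiplicative (ZMod p) × α) →* FreeGroup α :=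
  FreeGroup.lift fun e => of x ^ (Multiplicative.toAdd e.1).val * of e.2 *
    (of x ^ (Multiplicative.toAdd (e.1 * θ (of e.2))).val)⁻¹

/-- The collapsed edges form a path from `0` to `p - 1`, and powers of `x` travel along it from the
base point. Closing up a lift of `w` along this path frames `w` by such powers; for `θ w = 1` the
result is a conjugate of `w`. -/
theorem coverBack_coverHom (hx : θ (of x) = Multiplicative.ofAdd 1) (w : FreeGroup α) :
    ∀ j : Multiplicative (ZMod p), coverBack θ x ((coverHom θ x w).left j) =
      of x ^ (Multiplicative.toAdd j).val * w *
        (of x ^ (Multiplicative.toAdd (j * θ w)).val)⁻¹ := by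
  have hinv : ∀ w : FreeGroup α, (∀ j : Multiplicative (ZMod p),
      coverBack θ x ((coverHom θ x w).left j) =
        of x ^ (Multiplicative.toAdd j).val * w *
        (of x ^ (Multiplicative.toAdd (j * θ w)).val)⁻¹) →
      ∀ j : Multiplicative (ZMod p), coverBack θ x ((coverHom θ x w⁻¹).left j) =
      of x ^ (Multiplicative.toAdd j).val * w⁻¹ *
        (of x ^ (Multiplicative.toAdd (j * θ w⁻¹)).val)⁻¹ := by
    intro w h j
    rw [coverHom_inv_left, map_inv, h]
    have : (θ w)⁻¹ * j * θ w = j := by rw [mul_comm, mul_inv_cancel_left]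
    rw [this, map_inv, mul_comm j]
    group
  induction w using FreeGroup.induction_on with
  | C1 => intro j; simp
  | of y =>
    intro j
    rw [coverHom_of_left]
    by_cases h : y = x ∧ j ≠ Multiplicative.ofAdd (-1)
    · rw [edgeLabel, if_pos h, map_one, h.1, hx]
      -- The excluded value `j = -1` is the only one for which adding `1` wraps around.
      have h1 : (Multiplicative.toAdd (j * Multiplicative.ofAdd (1 : ZMod p))).val =
          (Multiplicative.toAdd j).val + 1 := by
        rw [toAdd_mul, toAdd_ofAdd]
        have : Fact (1 < p) := ⟨hp.out.one_lt⟩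
        have h2 := ZMod.val_lt (Multiplicative.toAdd j)
        have h3 : (Multiplicative.toAdd j).val + 1 ≠ p := fun h3 => h.2 (by
          apply Multiplicative.toAdd.injective
          rw [toAdd_ofAdd, eq_neg_iff_add_eq_zero]
          have h4 : (((Multiplicative.toAdd j).val + 1 : ℕ) : ZMod p) = 0 := by rw [h3]; simp
          simpa using h4)
        rw [ZMod.val_add_of_lt, ZMod.val_one]
        rw [ZMod.val_one]
        omega
      rw [h1, pow_succ]
      group
    · rw [edgeLabel, if_neg h]
      simp [coverBack]
  | inv_of y h => exact hinv _ h
  | mul v w hv hw =>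
    intro j
    rw [coverHom_mul_left, map_mul, hv, hw, map_mul θ]
    rw [mul_comm (θ v) j, ← mul_assoc j]
    group

theorem norm_edgeLabel_le (j : Multiplicative (ZMod p)) (y : α) :
    (edgeLabel x j y).norm ≤ 1 := by
  unfold edgeLabel
  split_ifs <;> simp

theorem norm_coverHom_letter_le (a : α × Bool) (j : Multiplicative (ZMod p)) :
    ((coverHom θ x (FreeGroup.mk [a])).left j).norm ≤ 1 := by
  obtain ⟨a, b⟩ := a
  cases b
  · have : FreeGroup.mk [(a, false)] = (of a)⁻¹ := by simp [of, inv_mk, invRev]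
    rw [this, coverHom_inv_left, norm_inv_eq, coverHom_of_left]
    exact norm_edgeLabel_le x _ _
  · change ((coverHom θ x (of a)).left j).norm ≤ 1
    rw [coverHom_of_left]
    exact norm_edgeLabel_le x _ _

theorem coverHom_cons_left (a : α × Bool) (L : List (α × Bool)) (j : Multiplicative (ZMod p)) :
    (coverHom θ x (FreeGroup.mk (a :: L))).left j =
      (coverHom θ x (FreeGroup.mk [a])).left j *
        (coverHom θ x (FreeGroup.mk L)).left (θ (FreeGroup.mk [a]) * j) := by
  rw [← coverHom_mul_left]
  simp [mul_mk]

theorem norm_coverHom_mk_le (L : List (α × Bool)) : ∀ j : Multiplicative (ZMod p),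
    ((coverHom θ x (FreeGroup.mk L)).left j).norm ≤ L.length := by
  induction L with
  | nil => intro j; simp [← one_eq_mk]
  | cons a L ih =>
    intro j
    rw [coverHom_cons_left, List.length_cons, add_comm]
    exact (FreeGroup.norm_mul_le _ _).trans (add_le_add (norm_coverHom_letter_le θ x a j) (ih _))

theorem exists_coverHom_letter_eq_one (b : Bool) :
    ∃ j : Multiplicative (ZMod p), (coverHom θ x (FreeGroup.mk [(x, b)])).left j = 1 := by
  have h1 : (1 : Multiplicative (ZMod p)) ≠ Multiplicative.ofAdd (-1) := by
    intro h
    have : (0 : ZMod p) = -1 := Multiplicative.ofAdd.injective h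
    exact one_ne_zero (α := ZMod p) (by simpa using this.symm)
  cases b
  · refine ⟨θ (of x), ?_⟩
    have : FreeGroup.mk [(x, false)] = (of x)⁻¹ := by simp [of, inv_mk, invRev]
    rw [this, coverHom_inv_left, coverHom_of_left, edgeLabel, if_pos ⟨rfl, by simp⟩]
    simp
  · refine ⟨1, ?_⟩
    change (coverHom θ x (of x)).left 1 = 1
    rw [coverHom_of_left, edgeLabel, if_pos ⟨rfl, h1⟩]

/-- A suitable starting point makes the lift cross a collapsed edge at an occurrence of `x`, which
saves one letter. This drop in length drives the induction for conjugacy separability. -/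
theorem exists_norm_coverHom_mk_lt (b : Bool) (L : List (α × Bool)) (hL : (x, b) ∈ L) :
    ∃ j : Multiplicative (ZMod p),
      ((coverHom θ x (FreeGroup.mk L)).left j).norm < L.length := by
  induction L with
  | nil => simp at hL
  | cons a L ih =>
    rcases List.mem_cons.mp hL with h | h
    · obtain ⟨j, hj⟩ := exists_coverHom_letter_eq_one θ x b
      refine ⟨j, ?_⟩
      rw [coverHom_cons_left, ← h, hj, one_mul, List.length_cons]
      exact Nat.lt_succ_of_le (norm_coverHom_mk_le θ x L _)
    · obtain ⟨j, hj⟩ := ih h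
      refine ⟨(θ (FreeGroup.mk [a]))⁻¹ * j, ?_⟩
      rw [coverHom_cons_left, List.length_cons, add_comm, mul_inv_cancel_left]
      exact (FreeGroup.norm_mul_le _ _).trans_lt
        (add_lt_add_of_le_of_lt (norm_coverHom_letter_le θ x a _) hj)

/-- Functoriality of the wreath product in the base group. -/
def wreathMap {D E Q : Type} [Group D] [Group E] [Group Q] (f : D →* E) : D ≀ᵣ Q →* E ≀ᵣ Q where
  toFun a := ⟨fun q => f (a.left q), a.right⟩
  map_one' := by ext <;> simp
  map_mul' a b := by ext <;> simp

end Wreath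

theorem isPGroup_wreath {D : Type} [Group D] [Finite D] {p : ℕ} [hp : Fact p.Prime]
    (hD : IsPGroup p D) : IsPGroup p (D ≀ᵣ Multiplicative (ZMod p)) := by
  obtain ⟨k, hk⟩ := IsPGroup.iff_card.mp hD
  refine IsPGroup.of_card (n := k * p + 1) ?_
  rw [RegularWreathProduct.card, hk]
  simp [pow_mul, pow_succ]

/-- The inductive step for conjugacy `p`-separability. -/
theorem separate_step {p : ℕ} [hp : Fact p.Prime] {α : Type} [DecidableEq α]
    {u v : FreeGroup α} (huv : ¬ IsConj u v)
    (ih : ∀ (u' v' : FreeGroup (Multiplicative (ZMod p) × α)),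
      u'.norm + v'.norm < u.norm + v.norm → ¬ IsConj u' v' →
      ∃ (Q : Type) (_ : Group Q) (_ : Finite Q) (_ : IsPGroup p Q)
        (f : FreeGroup (Multiplicative (ZMod p) × α) →* Q), ¬ IsConj (f u') (f v'))
    (θ : FreeGroup α →* Multiplicative (ZMod p)) (x : α) (hu : θ u = 1) (hv : θ v = 1)
    (hx : θ (of x) = Multiplicative.ofAdd 1) (hxu : ∃ b, (x, b) ∈ u.toWord) :
    ∃ (Q : Type) (_ : Group Q) (_ : Finite Q) (_ : IsPGroup p Q) (f : FreeGroup α →* Q),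
      ¬ IsConj (f u) (f v) := by
  obtain ⟨b, hb⟩ := hxu
  obtain ⟨j, hj⟩ := exists_norm_coverHom_mk_lt θ x b _ hb
  rw [mk_toWord] at hj
  have hlt : ∀ i, ((coverHom θ x u).left j).norm + ((coverHom θ x v).left i).norm <
      u.norm + v.norm := fun i => by
    refine add_lt_add_of_lt_of_le hj ?_
    have := norm_coverHom_mk_le θ x v.toWord i
    rwa [mk_toWord] at this
  -- Since `u` and `v` lie in the kernel of `θ`, mapping lifts back recovers them up to conjugacy,
  -- so no lift of `v` is conjugate to the chosen lift of `u`.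
  have hback : ∀ w, θ w = 1 → ∀ i, IsConj w (coverBack θ x ((coverHom θ x w).left i)) := by
    intro w hw i
    rw [coverBack_coverHom θ x hx, hw, mul_one]
    exact isConj_iff.mpr ⟨_, rfl⟩
  have hnc : ∀ i, ¬ IsConj ((coverHom θ x u).left j) ((coverHom θ x v).left i) := fun i h =>
    huv (((hback u hu j).trans ((coverBack θ x).map_isConj h)).trans (hback v hv i).symm)
  -- A conjugating element of the wreath product may shift the starting point, so the lift of `u`
  -- must be separated from all `p` lifts of `v` at once; the product of the `p`-groups does this.
  choose Q hG hF hP f hf using fun i => ih _ _ (hlt i) (hnc i)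
  have hPi : IsPGroup p (∀ i, Q i) := by
    choose k hk using fun i => IsPGroup.iff_card.mp (hP i)
    refine IsPGroup.of_card (n := ∑ i, k i) ?_
    rw [Nat.card_pi, Finset.prod_congr rfl fun i _ => hk i, Finset.prod_pow_eq_pow_sum]
  refine ⟨(∀ i, Q i) ≀ᵣ Multiplicative (ZMod p), inferInstance,
    Finite.of_equiv _ (RegularWreathProduct.equivProd _ _).symm, isPGroup_wreath hPi,
    (wreathMap (MonoidHom.pi f)).comp (coverHom θ x), fun hc => ?_⟩
  obtain ⟨c, hc⟩ := isConj_iff.mp hc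
  have h1 := congrArg (fun a => a.left) (mul_inv_eq_iff_eq_mul.mp hc)
  -- At this position the lift of `u` from `j` meets the lift of `v` from `c.right * j`, and `θ v =
  -- 1` makes the same component of `c` appear on both sides.
  have h2 := congrFun h1 (c.right * j)
  simp only [MonoidHom.comp_apply, RegularWreathProduct.mul_left, Pi.mul_apply, wreathMap,
    MonoidHom.coe_mk, OneHom.coe_mk, coverHom_right, hv, inv_one, one_mul,
    inv_mul_cancel_left] at h2
  have h3 := congrFun h2 (c.right * j)
  simp only [Pi.mul_apply, MonoidHom.pi_apply] at h3
  exact hf (c.right * j) (isConj_iff.mpr ⟨c.left (c.right * j) (c.right * j),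
    mul_inv_eq_iff_eq_mul.mpr h3⟩)

/-- Free groups of finite rank are conjugacy `p`-separable. -/
theorem exists_pGroup_not_isConj {p : ℕ} [hp : Fact p.Prime] {α : Type}
    {u v : FreeGroup α} (huv : ¬ IsConj u v) :
    ∃ (Q : Type) (_ : Group Q) (_ : Finite Q) (_ : IsPGroup p Q) (f : FreeGroup α →* Q),
      ¬ IsConj (f u) (f v) := by
  classical
  -- The cover has the larger alphabet `ℤ/p × α`, so the induction on total length runs over all
  -- alphabets.
  have key : ∀ (N : ℕ) (α : Type) (u v : FreeGroup α), u.norm + v.norm < N → ¬ IsConj u v →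
      ∃ (Q : Type) (_ : Group Q) (_ : Finite Q) (_ : IsPGroup p Q) (f : FreeGroup α →* Q),
        ¬ IsConj (f u) (f v) := by
    intro N
    induction N with
    | zero => intro α u v h; omega
    | succ N ih =>
      intro α u v hN huv
      by_cases h : ∀ a, expSum a u = expSum a v
      · have hne : u ≠ v := fun h => huv (h ▸ IsConj.refl u)
        obtain ⟨θ, x, hu, hv, hx, hl | hl⟩ := exists_character_mod_p (p := p) hne h
        · refine separate_step huv (fun u' v' h' => ih _ u' v' ?_) θ x hu hv hx hl
          convert! lt_of_lt_of_le h' (Nat.le_of_lt_succ hN)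
        · obtain ⟨Q, hG, hF, hP, f, hf⟩ := separate_step (fun h => huv h.symm)
            (fun u' v' h' => ih _ u' v' (by
              convert! lt_of_lt_of_le h' ((add_comm _ _).trans_le (Nat.le_of_lt_succ hN))))
            θ x hv hu hx hl
          exact ⟨Q, hG, hF, hP, f, fun h => hf h.symm⟩
      · push Not at h
        obtain ⟨a, ha⟩ := h
        exact separate_of_expSum_ne ha
  exact key _ α u v (Nat.lt_succ_self _) huv

end ConjugacySeparability

end FreeGroupDetection

namespace FreeGroupDetection

/-! ### Counting letters in conjugates of cyclically reduced words -/

section Words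

open FreeGroup hiding map_mul map_one map_inv norm_mul_le

variable {α : Type} [DecidableEq α]

/-- The number of letters satisfying `P` in the reduced word of `w`. -/
def letterCount (P : α → Prop) [DecidablePred P] (w : FreeGroup α) : ℕ :=
  w.toWord.countP fun a => decide (P a.1)

section Count

variable (P : α → Prop) [DecidablePred P]

theorem letterCount_mul_le (v w : FreeGroup α) :
    letterCount P (v * w) ≤ letterCount P v + letterCount P w := by
  unfold letterCount
  rw [← List.countP_append]
  exact (toWord_mul_sublist v w).countP_le

theorem letterCount_inv (w : FreeGroup α) : letterCount P w⁻¹ = letterCount P w := by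
  unfold letterCount
  rw [toWord_inv, invRev, List.countP_reverse, List.countP_map]
  rfl

theorem letterCount_pow_le (w : FreeGroup α) (k : ℕ) :
    letterCount P (w ^ k) ≤ k * letterCount P w := by
  induction k with
  | zero => simp [letterCount]
  | succ k ih =>
    rw [pow_succ, add_mul, one_mul]
    exact (letterCount_mul_le P _ _).trans (Nat.add_le_add_right ih _)

theorem letterCount_pow_of_isCyclicallyReduced {w : FreeGroup α}
    (hw : IsCyclicallyReduced w.toWord) (k : ℕ) :
    letterCount P (w ^ k) = k * letterCount P w := by
  unfold letterCount
  rw [toWord_pow, (hw.flatten_replicate k).isReduced.reduce_eq, List.countP_flatten]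
  simp

/-- Cyclically reduced words have the fewest letters of each kind among their conjugates. -/
theorem letterCount_le_of_isConj {w c : FreeGroup α} (hw : IsCyclicallyReduced w.toWord)
    (h : IsConj c w) : letterCount P w ≤ letterCount P c := by
  obtain ⟨g, rfl⟩ := isConj_iff.mp h
  by_contra! hlt
  -- Counts in powers of a cyclically reduced word grow exactly linearly, whereas conjugation by `g`
  -- changes a count by at most `2 * letterCount P g`; a deficit of one per factor exceeds this for
  -- the `k`-th power.
  set k := 2 * letterCount P g + 1 with hk
  have h1 : k * letterCount P (g * c * g⁻¹) ≤
      letterCount P g + k * letterCount P c + letterCount P g := by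
    rw [← letterCount_pow_of_isCyclicallyReduced P hw, conj_pow]
    calc letterCount P (g * c ^ k * g⁻¹)
        ≤ letterCount P (g * c ^ k) + letterCount P g⁻¹ := letterCount_mul_le P _ _
      _ ≤ letterCount P g + letterCount P (c ^ k) + letterCount P g⁻¹ :=
          Nat.add_le_add_right (letterCount_mul_le P _ _) _
      _ ≤ _ := by
          rw [letterCount_inv]
          have := letterCount_pow_le P c k
          omega
  have h2 := Nat.mul_le_mul_left k (Nat.succ_le_of_lt hlt)
  rw [Nat.mul_succ] at h2
  omega

end Count

/-- The standard free factor generated by a set of letters. -/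
def letterSubgroup (X : Set α) : Subgroup (FreeGroup α) := Subgroup.closure (of '' X)

omit [DecidableEq α] in
theorem mk_mem_letterSubgroup {X : Set α} {L : List (α × Bool)} (h : ∀ a ∈ L, a.1 ∈ X) :
    FreeGroup.mk L ∈ letterSubgroup X := by
  induction L with
  | nil => exact one_mem _
  | cons a L ih =>
    have h1 : FreeGroup.mk (a :: L) = FreeGroup.mk [a] * FreeGroup.mk L := by simp [mul_mk]
    rw [h1]
    refine mul_mem ?_ (ih fun b hb => h b (List.mem_cons_of_mem _ hb))
    have h2 : of a.1 ∈ letterSubgroup X :=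
      Subgroup.subset_closure ⟨_, h a List.mem_cons_self, rfl⟩
    obtain ⟨a, b⟩ := a
    cases b
    · have : FreeGroup.mk [(a, false)] = (of a)⁻¹ := by simp [of, inv_mk, invRev]
      rw [this]
      exact inv_mem h2
    · exact h2

theorem mem_letterSubgroup_iff {X : Set α} {w : FreeGroup α} :
    w ∈ letterSubgroup X ↔ ∀ a ∈ w.toWord, a.1 ∈ X := by
  refine ⟨fun h => ?_, fun h => mk_toWord (x := w) ▸ mk_mem_letterSubgroup h⟩
  refine Subgroup.closure_induction (p := fun w _ => ∀ a ∈ w.toWord, a.1 ∈ X) ?_ ?_ ?_ ?_ h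
  · rintro _ ⟨x, hx, rfl⟩
    simpa using hx
  · simp
  · intro v w _ _ hv hw a ha
    rcases List.mem_append.mp ((toWord_mul_sublist v w).subset ha) with h | h
    exacts [hv a h, hw a h]
  · intro v _ hv a ha
    rw [toWord_inv, invRev, List.mem_reverse, List.mem_map] at ha
    obtain ⟨b, hb, rfl⟩ := ha
    exact hv b hb

/-- Representatives of minimal length of double cosets of two standard free factors. -/
theorem exists_double_coset_rep (X Y : Set α) (h : FreeGroup α) :
    ∃ a ∈ letterSubgroup X, ∃ b ∈ letterSubgroup Y, ∃ g, h = a * g * b ∧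
      (∀ l ∈ g.toWord.head?, l.1 ∉ X) ∧ (∀ l ∈ g.toWord.getLast?, l.1 ∉ Y) := by
  let S : Set (FreeGroup α) :=
    {g | ∃ a ∈ letterSubgroup X, ∃ b ∈ letterSubgroup Y, h = a * g * b}
  -- A first letter of `g` in `X` or a last letter in `Y` could be absorbed into `a` or `b`,
  -- contradicting minimality.
  obtain ⟨g, ⟨a, ha, b, hb, hg⟩, hmin⟩ := (measure (FreeGroup.norm (α := α))).wf.has_min S
    ⟨h, 1, one_mem _, 1, one_mem _, by simp⟩
  refine ⟨a, ha, b, hb, g, hg, fun l hl hX => ?_, fun l hl hY => ?_⟩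
  · obtain ⟨L, hL⟩ : ∃ L, g.toWord = l :: L := by
      rcases hw : g.toWord with _ | ⟨l', L⟩
      · simp [hw] at hl
      · simp [hw] at hl
        exact ⟨L, by rw [hl]⟩
    have h1 : g = FreeGroup.mk [l] * FreeGroup.mk L := by
      rw [mul_mk, List.singleton_append, ← hL, mk_toWord]
    refine hmin (FreeGroup.mk L) ⟨a * FreeGroup.mk [l],
      mul_mem ha (mk_mem_letterSubgroup (by simpa using hX)), b, hb, ?_⟩ ?_
    · rw [hg, h1]; group
    · change (FreeGroup.mk L).norm < g.norm
      refine lt_of_le_of_lt norm_mk_le ?_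
      rw [FreeGroup.norm, hL, List.length_cons]
      exact Nat.lt_succ_self _
  · obtain ⟨L, hL⟩ : ∃ L, g.toWord = L ++ [l] := by
      rw [Option.mem_def, List.getLast?_eq_some_iff] at hl
      exact hl
    have h1 : g = FreeGroup.mk L * FreeGroup.mk [l] := by
      rw [mul_mk, ← hL, mk_toWord]
    refine hmin (FreeGroup.mk L) ⟨a, ha, FreeGroup.mk [l] * b,
      mul_mem (mk_mem_letterSubgroup (by simpa using hY)) hb, ?_⟩ ?_
    · rw [hg, h1]; group
    · change (FreeGroup.mk L).norm < g.norm
      refine lt_of_le_of_lt norm_mk_le ?_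
      rw [FreeGroup.norm, hL, List.length_append, List.length_singleton]
      exact Nat.lt_succ_self _

omit [DecidableEq α] in
theorem isReduced_append {L M : List (α × Bool)} (hL : IsReduced L) (hM : IsReduced M)
    (h : ∀ a ∈ L.getLast?, ∀ b ∈ M.head?, a.1 ≠ b.1) : IsReduced (L ++ M) :=
  List.isChain_append.mpr ⟨hL, hM, fun a ha b hb hab => absurd hab (h a ha b hb)⟩

theorem toWord_ne_nil {w : FreeGroup α} (h : w ≠ 1) : w.toWord ≠ [] :=
  fun h' => h (toWord_eq_nil_iff.mp h')

theorem toWord_of_isReduced {w : FreeGroup α} {L : List (α × Bool)} (hL : IsReduced L)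
    (h : w = FreeGroup.mk L) : w.toWord = L := by
  rw [h, toWord_mk, hL.reduce_eq]

omit [DecidableEq α] in
theorem getLast?_invRev_fst {L : List (α × Bool)} {a : α × Bool} (ha : a ∈ (invRev L).getLast?) :
    ∃ b ∈ L.head?, b.1 = a.1 := by
  rw [invRev, List.getLast?_reverse, List.head?_map] at ha
  simp only [Option.mem_def, Option.map_eq_some_iff] at ha
  obtain ⟨b, hb, rfl⟩ := ha
  exact ⟨b, hb, rfl⟩

omit [DecidableEq α] in
theorem head?_invRev_fst {L : List (α × Bool)} {a : α × Bool} (ha : a ∈ (invRev L).head?) :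
    ∃ b ∈ L.getLast?, b.1 = a.1 := by
  rw [invRev, List.head?_reverse, List.getLast?_map] at ha
  simp only [Option.mem_def, Option.map_eq_some_iff] at ha
  obtain ⟨b, hb, rfl⟩ := ha
  exact ⟨b, hb, rfl⟩

/-- The words `a g b g⁻¹` with `a`, `b` in standard free factors and `g` a minimal double coset
representative are cyclically reduced. -/
theorem toWord_mul_conj {X Y : Set α} {a b g : FreeGroup α} (ha : a ∈ letterSubgroup X)
    (hb : b ∈ letterSubgroup Y) (ha1 : a ≠ 1) (hb1 : b ≠ 1) (hg1 : g ≠ 1)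
    (hgX : ∀ l ∈ g.toWord.head?, l.1 ∉ X) (hgY : ∀ l ∈ g.toWord.getLast?, l.1 ∉ Y) :
    (a * (g * b * g⁻¹)).toWord = a.toWord ++ g.toWord ++ b.toWord ++ invRev g.toWord ∧
      IsCyclicallyReduced (a * (g * b * g⁻¹)).toWord := by
  rw [mem_letterSubgroup_iff] at ha hb
  have hab : IsReduced (a.toWord ++ g.toWord ++ b.toWord ++ invRev g.toWord) := by
    refine IsReduced.append_overlap (IsReduced.append_overlap ?_ ?_ (toWord_ne_nil hg1)) ?_
      (toWord_ne_nil hb1)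
    · refine isReduced_append isReduced_toWord isReduced_toWord fun l hl m hm h => ?_
      exact hgX m hm (h ▸ ha l (List.mem_of_getLast? hl))
    · refine isReduced_append isReduced_toWord isReduced_toWord fun l hl m hm h => ?_
      exact hgY l hl (h ▸ hb m (List.mem_of_head? hm))
    · refine isReduced_append isReduced_toWord ?_ fun l hl m hm h => ?_
      · rw [← toWord_inv]; exact isReduced_toWord
      · obtain ⟨m', hm', he⟩ := head?_invRev_fst hm
        exact hgY m' hm' (he ▸ h ▸ hb l (List.mem_of_getLast? hl))
  have hw : (a * (g * b * g⁻¹)).toWord =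
      a.toWord ++ g.toWord ++ b.toWord ++ invRev g.toWord := by
    refine toWord_of_isReduced hab ?_
    rw [← mul_mk, ← mul_mk, ← mul_mk, ← inv_mk, mk_toWord, mk_toWord, mk_toWord]
    group
  refine ⟨hw, ?_⟩
  rw [hw]
  refine ⟨hab, fun l hl m hm h => ?_⟩
  exfalso
  have hne : invRev g.toWord ≠ [] := by
    rw [← toWord_inv]
    exact toWord_ne_nil (inv_ne_one.mpr hg1)
  rw [List.getLast?_append_of_ne_nil _ hne] at hl
  obtain ⟨l', hl', he⟩ := getLast?_invRev_fst hl
  have hm' : m ∈ a.toWord.head? := by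
    rw [List.append_assoc, List.append_assoc, List.head?_append_of_ne_nil _ (toWord_ne_nil ha1)]
      at hm
    exact hm
  exact hgX l' hl' (he ▸ h ▸ ha m (List.mem_of_head? hm'))

/-- A product `a g b g⁻¹` of nontrivial elements of a standard free factor and of a different
conjugate of it is not conjugate into the free factor. -/
theorem mem_letterSubgroup_of_isConj {X : Set α} {a b g c : FreeGroup α}
    (ha : a ∈ letterSubgroup X) (hb : b ∈ letterSubgroup X) (ha1 : a ≠ 1) (hb1 : b ≠ 1)
    (hc : c ∈ letterSubgroup X) (h : IsConj c (a * (g * b * g⁻¹))) : g ∈ letterSubgroup X := by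
  classical
  -- If `g'` is nontrivial, the product is conjugate to a cyclically reduced word containing the
  -- first letter of `g'`, which is not in `X`. By minimality of letter counts no conjugate then
  -- lies in the factor.
  obtain ⟨a', ha', b', hb', g', hg, hX, hY⟩ := exists_double_coset_rep X X g
  by_cases hg1 : g' = 1
  · rw [hg, hg1, mul_one]
    exact mul_mem ha' hb'
  exfalso
  obtain ⟨hw, hcyc⟩ := toWord_mul_conj (a := a'⁻¹ * a * a') (b := b' * b * b'⁻¹)
    (mul_mem (mul_mem (inv_mem ha') ha) ha') (mul_mem (mul_mem hb' hb) (inv_mem hb'))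
    (fun h => ha1 (by
      have := congrArg (fun z => a' * z * a'⁻¹) h
      simpa [mul_assoc] using this))
    (fun h => hb1 (by simpa using h)) hg1 hX hY
  have hconj : IsConj c (a'⁻¹ * a * a' * (g' * (b' * b * b'⁻¹) * g'⁻¹)) := by
    refine h.trans (isConj_iff.mpr ⟨a'⁻¹, ?_⟩)
    rw [hg]
    group
  have hle := letterCount_le_of_isConj (fun x => x ∉ X) hcyc hconj
  have h0 : letterCount (fun x => x ∉ X) c = 0 := by
    rw [letterCount, List.countP_eq_zero]
    intro l hl
    simpa using mem_letterSubgroup_iff.mp hc l hl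
  rw [h0, Nat.le_zero, letterCount, List.countP_eq_zero] at hle
  obtain ⟨l, L, hL⟩ := List.exists_cons_of_ne_nil (toWord_ne_nil hg1)
  refine hX l (by simp [hL]) ?_
  have := hle l (by rw [hw, hL]; simp)
  simpa using this

/-- A subgroup all of whose elements are conjugate into a standard free factor is conjugate into
this free factor. -/
theorem exists_conj_le_letterSubgroup {X : Set α} (H : Subgroup (FreeGroup α))
    (hH : ∀ h ∈ H, ∃ a ∈ letterSubgroup X, IsConj h a) :
    ∃ g, ∀ h ∈ H, g * h * g⁻¹ ∈ letterSubgroup X := by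
  by_cases h0 : ∀ h ∈ H, h = 1
  · exact ⟨1, fun h hh => by rw [h0 h hh]; simp⟩
  push Not at h0
  obtain ⟨k, hk, hk1⟩ := h0
  obtain ⟨a, ha, hka⟩ := hH k hk
  obtain ⟨g, rfl⟩ := isConj_iff.mp hka
  refine ⟨g, fun h hh => ?_⟩
  by_cases hh1 : h = 1
  · rw [hh1]; simp
  obtain ⟨b, hb, hhb⟩ := hH h hh
  -- The product `k * h` links the conjugator of `h` to that of the fixed nontrivial element `k`.
  obtain ⟨c, hc, hhc⟩ := hH (k * h) (mul_mem hk hh)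
  obtain ⟨q, hq⟩ := isConj_iff.mp hhb
  have hb1 : b ≠ 1 := fun hb1 => hh1 (isConj_one_left.mp (hb1 ▸ hhb))
  have hmem : g * q⁻¹ ∈ letterSubgroup X := by
    refine mem_letterSubgroup_of_isConj ha hb (fun h => hk1 (by simpa using h)) hb1 hc
      (hhc.symm.trans (isConj_iff.mpr ⟨g, ?_⟩))
    rw [← hq]
    group
  have : g * h * g⁻¹ = (g * q⁻¹) * b * (g * q⁻¹)⁻¹ := by
    rw [← hq]
    group
  rw [this]
  exact mul_mem (mul_mem hmem hb) (inv_mem hmem)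

/-- For a nontrivial double coset representative `g` of `h`, the word `x g y g⁻¹` is cyclically
reduced of length greater than two, so it is not conjugate to `x y`. -/
theorem exists_eq_zpow_mul_zpow {x y : α} {h : FreeGroup α}
    (hc : IsConj (of x * of y) (of x * (h * of y * h⁻¹))) :
    ∃ m k : ℤ, h = of x ^ m * of y ^ k := by
  obtain ⟨a, ha, b, hb, g, hg, hX, hY⟩ := exists_double_coset_rep {x} {y} h
  have hxm : ∀ z : α, letterSubgroup {z} = Subgroup.zpowers (of z) := fun z => by
    rw [letterSubgroup, Set.image_singleton, Subgroup.zpowers_eq_closure]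
  rw [hxm] at ha hb
  obtain ⟨m, rfl⟩ := Subgroup.mem_zpowers_iff.mp ha
  obtain ⟨k, rfl⟩ := Subgroup.mem_zpowers_iff.mp hb
  by_cases hg1 : g = 1
  · exact ⟨m, k, by rw [hg, hg1, mul_one]⟩
  exfalso
  have hof : ∀ z : α, of z ∈ letterSubgroup {z} := fun z => Subgroup.subset_closure ⟨z, rfl, rfl⟩
  obtain ⟨hw, hcyc⟩ := toWord_mul_conj (hof x) (hof y) (of_ne_one x) (of_ne_one y) hg1 hX hY
  have hconj : IsConj (of x * of y) (of x * (g * of y * g⁻¹)) := by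
    refine hc.trans (isConj_iff.mpr ⟨(of x ^ m)⁻¹, ?_⟩)
    rw [hg]
    group
  have hle := letterCount_le_of_isConj (fun _ => True) hcyc hconj
  have h1 : ∀ w : FreeGroup α, letterCount (fun _ => True) w = w.norm := fun w => by
    simp [letterCount, FreeGroup.norm]
  have h2 := FreeGroup.norm_mul_le (of x) (of y)
  have h3 := List.length_pos_iff.mpr (toWord_ne_nil hg1)
  rw [h1, h1, FreeGroup.norm, hw] at hle
  simp only [norm_of] at h2
  simp at hle
  omega

theorem exists_conjugators_eq {ψ : MulAut (FreeGroup α)} (hψ : ∀ g, IsConj g (ψ g)) {x y : α}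
    {c d : FreeGroup α} (hx : ψ (of x) = c * of x * c⁻¹) (hy : ψ (of y) = d * of y * d⁻¹) :
    ∃ m k : ℤ, c⁻¹ * d = of x ^ m * of y ^ k := by
  apply exists_eq_zpow_mul_zpow
  refine (hψ _).trans (isConj_iff.mpr ⟨c⁻¹, ?_⟩)
  rw [map_mul, hx, hy]
  group

/-- Pointwise inner automorphisms of nonabelian free groups are inner. -/
theorem exists_conj_of_pointwise_inner {x₀ x₁ : α} (hne : x₀ ≠ x₁) {ψ : MulAut (FreeGroup α)}
    (hψ : ∀ g, IsConj g (ψ g)) : ∃ c, ψ = MulAut.conj c := by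
  choose d hd using fun b => isConj_iff.mp (hψ (of b))
  obtain ⟨m, k, hmk⟩ := exists_conjugators_eq hψ (hd x₀).symm (hd x₁).symm
  -- A conjugator for `x₀` is only determined up to powers of `x₀` on the right, and likewise for
  -- `x₁`; the relation `hmk` allows both to be adjusted to a common `c`.
  set c := d x₀ * of x₀ ^ m with hc
  have hc' : c = d x₁ * (of x₁ ^ k)⁻¹ := by
    rw [hc, eq_mul_inv_iff_mul_eq, mul_assoc, ← hmk, mul_inv_cancel_left]
  have h0 : ψ (of x₀) = c * of x₀ * c⁻¹ := by
    rw [← hd x₀, hc]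
    group
  have h1 : ψ (of x₁) = c * of x₁ * c⁻¹ := by
    rw [← hd x₁, hc']
    group
  refine ⟨c, MulEquiv.toMonoidHom_injective (FreeGroup.ext_hom _ _ fun b => ?_)⟩
  change ψ (of b) = c * of b * c⁻¹
  by_cases hb0 : b = x₀
  · rw [hb0, h0]
  by_cases hb1 : b = x₁
  · rw [hb1, h1]
  -- Comparison with `x₀` and with `x₁` gives two expressions for `c⁻¹ * d b`; the exponent sum of
  -- `x₀` vanishes in the second one, so `m' = 0`.
  obtain ⟨m', k', h2⟩ := exists_conjugators_eq hψ h0 (hd b).symm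
  obtain ⟨m'', k'', h3⟩ := exists_conjugators_eq hψ h1 (hd b).symm
  have h4 := congrArg (expSum x₀) (h2.symm.trans h3)
  simp only [map_mul, map_zpow, expSum_of_self, expSum_of_ne hb0, expSum_of_ne hne.symm, one_zpow,
    mul_one] at h4
  have h5 : m' = 0 := by
    have := congrArg Multiplicative.toAdd h4
    simpa using this
  rw [h5, zpow_zero, one_mul, inv_mul_eq_iff_eq_mul] at h2
  rw [← hd b, h2]
  group

end Words

end FreeGroupDetection

namespace FreeGroupDetection

/-! ### Irreducible characters separate the conjugacy classes of a finite group -/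

section Characters

open scoped MonoidAlgebra

theorem isIrreducible_iff {G V : Type} [Group G] [AddCommGroup V] [Module ℂ V]
    (ρ : Representation ℂ G V) : ρ.IsIrreducible ↔ Nontrivial V ∧
      ∀ W : Submodule ℂ V, (∀ g, ∀ v ∈ W, ρ g v ∈ W) → W = ⊥ ∨ W = ⊤ := by
  constructor
  · intro h
    refine ⟨?_, fun W hW => ?_⟩
    · by_contra hV
      rw [not_nontrivial_iff_subsingleton] at hV
      obtain ⟨a, b, hab⟩ := h.toNontrivial
      exact hab (Subrepresentation.toSubmodule_injective (Subsingleton.elim _ _))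
    · rcases h.eq_bot_or_eq_top ⟨W, fun g v hv => hW g v hv⟩ with h | h
      · exact Or.inl (congrArg Subrepresentation.toSubmodule h)
      · exact Or.inr (congrArg Subrepresentation.toSubmodule h)
  · rintro ⟨hV, h⟩
    have : Nontrivial (Subrepresentation ρ) := by
      refine ⟨⊥, ⊤, fun hb => ?_⟩
      have h1 : (⊥ : Submodule ℂ V) = ⊤ := congrArg Subrepresentation.toSubmodule hb
      exact bot_ne_top h1
    refine ⟨fun W => ?_⟩
    rcases h W.toSubmodule fun g v hv => W.apply_mem_toSubmodule g hv with h | h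
    · exact Or.inl (Subrepresentation.toSubmodule_injective h)
    · exact Or.inr (Subrepresentation.toSubmodule_injective h)

variable {Q : Type} [Group Q] [Fintype Q]

/-- The sum of the conjugates of `g` in the group algebra. -/
noncomputable def conjSum (g : Q) : ℂ[Q] := ∑ q : Q, MonoidAlgebra.single (q * g * q⁻¹) 1

theorem single_mul_conjSum (g s : Q) :
    MonoidAlgebra.single s 1 * conjSum g = conjSum g * MonoidAlgebra.single s (1 : ℂ) := by
  rw [conjSum, Finset.mul_sum, Finset.sum_mul]
  refine Fintype.sum_equiv (Equiv.mulLeft s) _ _ fun q => ?_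
  simp only [MonoidAlgebra.single_mul_single, Equiv.coe_mulLeft, mul_one]
  congr 1
  group

theorem conjSum_commute (g : Q) (a : ℂ[Q]) : a * conjSum g = conjSum g * a := by
  induction a using MonoidAlgebra.induction_on with
  | of s => exact single_mul_conjSum g s
  | add a b ha hb => rw [add_mul, mul_add, ha, hb]
  | smul r a ha => rw [smul_mul_assoc, ha, mul_smul_comm]

theorem conjSum_ne {g h : Q} (hgh : ¬ IsConj g h) : conjSum g ≠ conjSum h := by
  intro he
  have h1 : (conjSum g).coeff g = (conjSum h).coeff g := by rw [he]
  classical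
  simp only [conjSum, MonoidAlgebra.coeff_sum, MonoidAlgebra.coeff_single, Finsupp.finsetSum_apply,
    Finsupp.single_apply] at h1
  have h2 : ∀ q : Q, q * h * q⁻¹ ≠ g := fun q hq => hgh (isConj_iff.mpr ⟨q, hq⟩).symm
  simp only [h2, if_false, Finset.sum_const_zero] at h1
  rw [Finset.sum_boole, Nat.cast_eq_zero, Finset.card_eq_zero] at h1
  have h3 : (1 : Q) ∈ Finset.univ.filter fun q : Q => q * g * q⁻¹ = g := by simp
  rw [h1] at h3
  simp at h3

theorem trace_asAlgebraHom_conjSum {V : Type} [AddCommGroup V] [Module ℂ V]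
    (ρ : Representation ℂ Q V) (g : Q) :
    LinearMap.trace ℂ V (ρ.asAlgebraHom (conjSum g)) = Fintype.card Q * ρ.character g := by
  rw [conjSum, map_sum, map_sum]
  simp only [Representation.asAlgebraHom_single_one]
  rw [Finset.sum_congr rfl fun q _ => ?_, Finset.sum_const, Finset.card_univ, nsmul_eq_mul]
  exact ρ.char_conj g q

/-- The irreducible characters of a finite group separate its conjugacy classes. -/
theorem exists_irreducible_character_ne {g h : Q} (hgh : ¬ IsConj g h) :
    ∃ (V : Type) (_ : AddCommGroup V) (_ : Module ℂ V) (_ : FiniteDimensional ℂ V)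
      (ρ : Representation ℂ Q V), ρ.IsIrreducible ∧ ρ.character g ≠ ρ.character h := by
  by_contra! hcon
  apply conjSum_ne hgh
  -- The central element `z` acts on a simple module by a scalar (Schur). Its trace is `|Q|` times a
  -- difference of character values, hence zero, so the scalar is zero. Semisimplicity of `ℂ[Q]`
  -- then gives `z * 1 = 0`.
  set z : ℂ[Q] := conjSum g - conjSum h with hz
  have hzc : ∀ a : ℂ[Q], a * z = z * a := fun a => by
    rw [hz, mul_sub, sub_mul, conjSum_commute, conjSum_commute]
  let Z : Submodule ℂ[Q] ℂ[Q] :=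
    { carrier := {a | z * a = 0}
      add_mem' := fun {a b} ha hb => by
        change z * (a + b) = 0
        rw [mul_add, ha, hb, add_zero]
      zero_mem' := mul_zero z
      smul_mem' := fun c a ha => by
        change z * (c * a) = 0
        rw [← mul_assoc, ← hzc, mul_assoc]
        change c * (z * a) = 0
        rw [ha, mul_zero] }
  have hle : sSup {S : Submodule ℂ[Q] ℂ[Q] | IsSimpleModule ℂ[Q] S} ≤ Z := by
    refine sSup_le fun S hS s hs => ?_
    have : IsSimpleModule ℂ[Q] S := hS
    have hfin : FiniteDimensional ℂ ℂ[Q] := inferInstance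
    have : FiniteDimensional ℂ S :=
      FiniteDimensional.of_injective (S.subtype.restrictScalars ℂ) Subtype.val_injective
    let ρ : Representation ℂ Q S := Representation.ofModule' S
    have hρ : ∀ (a : ℂ[Q]) (x : S), ρ.asAlgebraHom a x = a • x := fun a x => by
      have : ρ.asAlgebraHom = Algebra.lsmul ℂ ℂ S :=
        (MonoidAlgebra.lift ℂ (S →ₗ[ℂ] S) Q).apply_symm_apply _
      rw [this]
      rfl
    have hirr : ρ.IsIrreducible := by
      refine (isIrreducible_iff ρ).mpr ⟨IsSimpleModule.nontrivial ℂ[Q] S, fun W hW => ?_⟩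
      have hW' : ∀ (a : ℂ[Q]), ∀ x ∈ W, a • x ∈ W := fun a x hx => by
        rw [← hρ]
        induction a using MonoidAlgebra.induction_on with
        | of q =>
          rw [Representation.asAlgebraHom_of]
          exact hW q x hx
        | add a b ha hb => rw [map_add]; exact W.add_mem ha hb
        | smul r a ha => rw [map_smul]; exact W.smul_mem r ha
      let W' : Submodule ℂ[Q] S := { W with smul_mem' := hW' }
      rcases eq_bot_or_eq_top W' with h | h
      · exact Or.inl (SetLike.coe_injective (congrArg (fun X : Submodule ℂ[Q] S => (X : Set S)) h))
      · exact Or.inr (SetLike.coe_injective (congrArg (fun X : Submodule ℂ[Q] S => (X : Set S)) h))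
    have htr : LinearMap.trace ℂ S (ρ.asAlgebraHom z) = 0 := by
      rw [hz, map_sub, map_sub, trace_asAlgebraHom_conjSum, trace_asAlgebraHom_conjSum,
        hcon S _ _ inferInstance ρ hirr, sub_self]
    let f : Module.End ℂ[Q] S :=
      { toFun := fun x => z • x
        map_add' := smul_add z
        map_smul' := fun c x => by
          rw [RingHom.id_apply, smul_smul, smul_smul, hzc] }
    obtain ⟨c, hc⟩ := (IsSimpleModule.algebraMap_end_bijective_of_isAlgClosed
      (A := ℂ[Q]) (V := S) ℂ).2 f
    have hcz : ∀ x : S, z • x = c • x := fun x => (DFunLike.congr_fun hc x).symm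
    have h1 : ρ.asAlgebraHom z = c • LinearMap.id := by
      ext1 x
      rw [hρ, hcz]
      rfl
    rw [h1, map_smul, LinearMap.trace_id, smul_eq_mul, mul_eq_zero] at htr
    have : Nontrivial S := IsSimpleModule.nontrivial ℂ[Q] S
    have hc0 : c = 0 := htr.resolve_right
      (Nat.cast_ne_zero.mpr (Module.finrank_pos (R := ℂ) (M := S)).ne')
    have h2 := hcz ⟨s, hs⟩
    rw [hc0, zero_smul] at h2
    exact congrArg Subtype.val h2
  rw [IsSemisimpleModule.sSup_simples_eq_top] at hle
  have h1 : z * 1 = 0 := hle (Submodule.mem_top (x := (1 : ℂ[Q])))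
  rw [mul_one] at h1
  exact sub_eq_zero.mp h1

end Characters

end FreeGroupDetection

noncomputable section

open scoped TensorProduct

namespace FreeGroupDetection

/-! ### Representations on which a subgroup of finite index acts trivially -/

section Averaging

variable {G V W : Type} [Group G] [AddCommGroup V] [Module ℂ V] [AddCommGroup W] [Module ℂ W]

/-- This replaces averaging over the possibly infinite group `G` by a sum over arbitrary coset
representatives. -/
theorem sum_mul_out {X : Type} [AddCommMonoid X] (N : Subgroup G) [Fintype (G ⧸ N)] (F : G → X)
    (hF : ∀ g, ∀ x ∈ N, F (g * x) = F g) (h : G) :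
    ∑ q : G ⧸ N, F (h * q.out) = ∑ q : G ⧸ N, F q.out := by
  have key : ∀ a b : G, (a : G ⧸ N) = b → F a = F b := fun a b hab => by
    rw [← hF a _ (QuotientGroup.eq.mp hab), mul_inv_cancel_left]
  refine Fintype.sum_equiv (MulAction.toPerm h) _ _ fun q => key _ _ ?_
  rw [QuotientGroup.out_eq', MulAction.toPerm_apply]
  conv_rhs => rw [← QuotientGroup.out_eq' q]
  rfl

/-- Maschke's theorem for representations which factor through a finite quotient. -/
theorem exists_equivariant_section (N : Subgroup G) [N.FiniteIndex] (ρ : Representation ℂ G V)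
    (σ : Representation ℂ G W) (hρ : ∀ g ∈ N, ρ g = 1) (hσ : ∀ g ∈ N, σ g = 1)
    (T : V →ₗ[ℂ] W) (hT : ∀ g v, T (ρ g v) = σ g (T v)) (hs : Function.Surjective T) :
    ∃ s : W →ₗ[ℂ] V, (∀ g w, s (σ g w) = ρ g (s w)) ∧ ∀ w, T (s w) = w := by
  classical
  obtain ⟨s₀, hs₀⟩ := LinearMap.exists_rightInverse_of_surjective T (LinearMap.range_eq_top.mpr hs)
  have hs₀' : ∀ w, T (s₀ w) = w := fun w => DFunLike.congr_fun hs₀ w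
  have : Fintype (G ⧸ N) := Subgroup.fintypeQuotientOfFiniteIndex
  have hcard : (Fintype.card (G ⧸ N) : ℂ) ≠ 0 := Nat.cast_ne_zero.mpr Fintype.card_ne_zero
  let F : G → (W →ₗ[ℂ] V) := fun g => (ρ g).comp (s₀.comp (σ g⁻¹))
  have hF : ∀ g, ∀ x ∈ N, F (g * x) = F g := fun g x hx => by
    ext w
    simp only [F, LinearMap.comp_apply, mul_inv_rev, map_mul, hρ x hx, hσ x⁻¹ (inv_mem hx), mul_one,
      one_mul]
  have hFh : ∀ h g w, F (h * g) (σ h w) = ρ h (F g w) := fun h g w => by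
    simp only [F, LinearMap.comp_apply, mul_inv_rev, map_mul, Module.End.mul_apply]
    rw [← Module.End.mul_apply (σ h⁻¹), ← map_mul, inv_mul_cancel, map_one, Module.End.one_apply]
  refine ⟨(Fintype.card (G ⧸ N) : ℂ)⁻¹ • ∑ q : G ⧸ N, F q.out, fun g w => ?_, fun w => ?_⟩
  · conv_lhs => rw [← sum_mul_out N F hF g]
    simp only [LinearMap.smul_apply, LinearMap.sum_apply, hFh, map_smul, map_sum]
  · have h1 : ∀ g, T (F g w) = w := fun g => by
      simp only [F, LinearMap.comp_apply]
      rw [hT, hs₀', ← Module.End.mul_apply, ← map_mul, mul_inv_cancel, map_one, Module.End.one_apply]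
    simp only [LinearMap.smul_apply, LinearMap.sum_apply, map_smul, map_sum, h1, Finset.sum_const,
      Finset.card_univ]
    rw [← Nat.cast_smul_eq_nsmul ℂ, smul_smul, inv_mul_cancel₀ hcard, one_smul]

/-- A derivation vanishing on a subgroup of finite index is inner. -/
theorem exists_inner_of_derivation (N : Subgroup G) [N.FiniteIndex] (ρ : Representation ℂ G V)
    (d : G → V) (hd : ∀ g h, d (g * h) = d g + ρ g (d h)) (hN : ∀ g ∈ N, d g = 0) :
    ∃ w, ∀ g, d g = ρ g w - w := by
  classical
  have : Fintype (G ⧸ N) := Subgroup.fintypeQuotientOfFiniteIndex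
  have hcard : (Fintype.card (G ⧸ N) : ℂ) ≠ 0 := Nat.cast_ne_zero.mpr Fintype.card_ne_zero
  set c : ℂ := (Fintype.card (G ⧸ N) : ℂ) with hc
  -- Averaging `d (g * h) = d g + ρ g (d h)` over the cosets of `h` shows that minus the mean value
  -- of `d` is the required vector.
  refine ⟨-(c⁻¹ • ∑ q : G ⧸ N, d q.out), fun g => ?_⟩
  have h1 := sum_mul_out N d (fun g x hx => by rw [hd, hN x hx, map_zero, add_zero]) g
  simp only [hd, Finset.sum_add_distrib, Finset.sum_const, Finset.card_univ] at h1
  rw [← Nat.cast_smul_eq_nsmul ℂ, ← hc, ← map_sum] at h1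
  have h2 : d g = c⁻¹ • (c • d g) := by rw [smul_smul, inv_mul_cancel₀ hcard, one_smul]
  rw [h2, eq_sub_of_add_eq h1, map_neg, map_smul, smul_sub]
  abel

/-- Derivations of free groups can be prescribed on the generators. -/
theorem exists_derivation {α : Type} (ρ : Representation ℂ (FreeGroup α) V) (v : α → V) :
    ∃ d : FreeGroup α → V, (∀ g h, d (g * h) = d g + ρ g (d h)) ∧
      ∀ a, d (FreeGroup.of a) = v a := by
  have hinv : ∀ g x, ρ g⁻¹ (ρ g x) = x := fun g x => by
    rw [← Module.End.mul_apply, ← map_mul, inv_mul_cancel, map_one, Module.End.one_apply]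
  have hinv' : ∀ g x, ρ g (ρ g⁻¹ x) = x := fun g x => by
    rw [← Module.End.mul_apply, ← map_mul, mul_inv_cancel, map_one, Module.End.one_apply]
  -- A derivation is the translation part of an action by affine maps with linear part `ρ`, and a
  -- free group acts through any choice of permutations for its generators.
  let Φ : FreeGroup α →* Equiv.Perm V := FreeGroup.lift fun a =>
    { toFun := fun x => ρ (FreeGroup.of a) x + v a
      invFun := fun x => ρ (FreeGroup.of a)⁻¹ (x - v a)
      left_inv := fun x => by simp [hinv]
      right_inv := fun x => by simp [hinv'] }
  have key : ∀ g x, Φ g x = Φ g 0 + ρ g x := by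
    intro g
    induction g using FreeGroup.induction_on with
    | C1 => intro x; simp
    | of a => intro x; simp [Φ, add_comm]
    | inv_of a h =>
      intro x
      rw [map_inv, Equiv.Perm.inv_eq_iff_eq, h, map_add, hinv']
      have h0 := h ((Φ (FreeGroup.of a))⁻¹ 0)
      rw [show (Φ (FreeGroup.of a)) ((Φ (FreeGroup.of a))⁻¹ 0) = 0 from Equiv.apply_symm_apply _ _]
        at h0
      rw [← add_assoc, ← h0, zero_add]
    | mul g h hg hh =>
      intro x
      rw [map_mul, Equiv.Perm.mul_apply, Equiv.Perm.mul_apply, hg, hg (Φ h 0), hh x, map_add,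
        map_mul, Module.End.mul_apply, add_assoc]
  refine ⟨fun g => Φ g 0, fun g h => ?_, fun a => by simp [Φ]⟩
  simp only [map_mul, Equiv.Perm.mul_apply]
  rw [key]

end Averaging

/-! ### Generators of `H₁` -/

section Homology

/-- The homology class of a group element. -/
def H1.cls {N : Type} [Group N] (x : N) : H1 N :=
  (1 : ℂ) ⊗ₜ[ℤ] Additive.ofMul (Abelianization.of x)

theorem H1.map_cls {N M : Type} [Group N] [Group M] (f : N →* M) (x : N) :
    H1.map f (H1.cls x) = H1.cls (f x) := by
  simp [H1.map, H1.cls]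

theorem H1.span_cls (N : Type) [Group N] :
    Submodule.span ℂ (Set.range (H1.cls : N → H1 N)) = ⊤ := by
  rw [eq_top_iff]
  rintro x -
  induction x using TensorProduct.induction_on with
  | zero => exact zero_mem _
  | add x y hx hy => exact add_mem hx hy
  | tmul c a =>
    obtain ⟨y, hy⟩ : ∃ y : N, Additive.ofMul (Abelianization.of y) = a := by
      obtain ⟨y, hy⟩ := QuotientGroup.mk_surjective (Additive.toMul a)
      exact ⟨y, congrArg Additive.ofMul hy⟩
    have : c ⊗ₜ[ℤ] a = c • H1.cls y := by
      rw [H1.cls, hy, TensorProduct.smul_tmul', smul_eq_mul, mul_one]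
    rw [this]
    exact Submodule.smul_mem _ _ (Submodule.subset_span ⟨y, rfl⟩)

theorem H1.hom_ext {N W : Type} [Group N] [AddCommGroup W] [Module ℂ W] {f g : H1 N →ₗ[ℂ] W}
    (h : ∀ x, f (H1.cls x) = g (H1.cls x)) : f = g :=
  LinearMap.ext_on (H1.span_cls N) (by rintro _ ⟨x, rfl⟩; exact h x)

theorem H1.cls_pow {N : Type} [Group N] (x : N) (k : ℕ) : H1.cls (x ^ k) = (k : ℂ) • H1.cls x := by
  rw [H1.cls, map_pow, ofMul_pow, TensorProduct.tmul_smul, Nat.cast_smul_eq_nsmul]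
  rfl

theorem H1.cls_conj {N : Type} [Group N] (g x : N) : H1.cls (g * x * g⁻¹) = H1.cls x := by
  have : Abelianization.of (g * x * g⁻¹) = Abelianization.of x := by
    rw [map_mul, map_mul, map_inv, mul_comm, inv_mul_cancel_left]
  rw [H1.cls, this]
  rfl

/-- The homomorphism on `H₁` extending a homomorphism to a vector space. -/
theorem H1.exists_lift {N W : Type} [Group N] [AddCommGroup W] [Module ℂ W] (d : N → W)
    (hd : ∀ x y, d (x * y) = d x + d y) : ∃ T : H1 N →ₗ[ℂ] W, ∀ x, T (H1.cls x) = d x := by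
  let d' : N →* Multiplicative W := MonoidHom.mk' (fun x => Multiplicative.ofAdd (d x)) hd
  let l : Additive (Abelianization N) →+ W :=
    MonoidHom.toAdditiveLeft (Abelianization.lift d')
  refine ⟨LinearMap.liftBaseChange ℂ l.toIntLinearMap, fun x => ?_⟩
  rw [H1.cls, LinearMap.liftBaseChange_tmul, one_smul]
  rfl

variable {G : Type} [Group G]

/-- The power `x ^ N.index` lies in `N`, and the index is invertible in `ℂ`. -/
theorem H1.map_inclusion_surjective {N M : Subgroup G} (h : N ≤ M) [hN : N.Normal]
    [N.FiniteIndex] : Function.Surjective (H1.map (Subgroup.inclusion h)) := by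
  rw [← LinearMap.range_eq_top, eq_top_iff, ← H1.span_cls, Submodule.span_le]
  rintro _ ⟨x, rfl⟩
  have hk : (N.index : ℂ) ≠ 0 := Nat.cast_ne_zero.mpr Subgroup.FiniteIndex.index_ne_zero
  refine ⟨(N.index : ℂ)⁻¹ • H1.cls ⟨(x : G) ^ N.index, Subgroup.pow_index_mem N _⟩, ?_⟩
  rw [map_smul, H1.map_cls]
  have : Subgroup.inclusion h ⟨(x : G) ^ N.index, Subgroup.pow_index_mem N _⟩ = x ^ N.index := rfl
  rw [this, H1.cls_pow, smul_smul, inv_mul_cancel₀ hk, one_smul]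

/-- The conjugation action on `H₁(N; ℂ)`. -/
def conjRep (N : Subgroup G) (hN : N.Characteristic) : Representation ℂ G (H1 N) where
  toFun g := H1.map (restrictAut N hN (MulAut.conj g))
  map_one' := by
    refine H1.hom_ext fun x => ?_
    rw [H1.map_cls]
    congr 1
    ext
    simp [restrictAut]
  map_mul' g h := by
    refine H1.hom_ext fun x => ?_
    rw [Module.End.mul_apply, H1.map_cls, H1.map_cls, H1.map_cls]
    congr 1
    ext
    simp [restrictAut, mul_assoc]

theorem conjRep_cls (N : Subgroup G) (hN : N.Characteristic) (g : G) (x : N) :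
    conjRep N hN g (H1.cls x) = H1.cls (restrictAut N hN (MulAut.conj g) x) :=
  H1.map_cls _ _

theorem conjRep_eq_one (N : Subgroup G) (hN : N.Characteristic) {g : G} (hg : g ∈ N) :
    conjRep N hN g = 1 := by
  refine H1.hom_ext fun x => ?_
  rw [conjRep_cls, Module.End.one_apply, ← H1.cls_conj ⟨g, hg⟩ x]
  rfl

theorem map_inclusion_conjRep {N M : Subgroup G} (h : N ≤ M) (hN : N.Characteristic)
    (hM : M.Characteristic) (g : G) (x : H1 N) :
    H1.map (Subgroup.inclusion h) (conjRep N hN g x) =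
      conjRep M hM g (H1.map (Subgroup.inclusion h) x) := by
  have : (H1.map (Subgroup.inclusion h)).comp (conjRep N hN g) =
      (conjRep M hM g).comp (H1.map (Subgroup.inclusion h)) := H1.hom_ext fun y => by
    rw [LinearMap.comp_apply, LinearMap.comp_apply, conjRep_cls, H1.map_cls, H1.map_cls,
      conjRep_cls]
    rfl
  exact DFunLike.congr_fun this x

theorem map_inclusion_map_inclusion {N M L : Subgroup G} (h : N ≤ M) (h' : M ≤ L) (x : H1 N) :
    H1.map (Subgroup.inclusion h') (H1.map (Subgroup.inclusion h) x) =
      H1.map (Subgroup.inclusion (h.trans h')) x := by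
  rw [← LinearMap.comp_apply, ← H1.map_comp]
  rfl

end Homology

/-! ### Cofinal chains and sections of the projections from the inverse limit -/

section Cover

variable {G : Type} [Group G] {p : ℕ}

theorem PCoverSystem.finiteIndex (hp : p.Prime) (K : PCoverSystem G p) {N : Subgroup G}
    (hN : N ∈ K.carrier) : N.FiniteIndex := by
  obtain ⟨k, hk⟩ := K.index_eq N hN
  exact ⟨by rw [hk]; exact pow_ne_zero _ hp.ne_zero⟩

theorem PCoverSystem.normal (K : PCoverSystem G p) {N : Subgroup G}
    (hN : N ∈ K.carrier) : N.Normal :=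
  have := K.characteristic N hN
  inferInstance

theorem PCoverSystem.directed (hp : p.Prime) (K : PCoverSystem G p) {N M : Subgroup G}
    (hN : N ∈ K.carrier) (hM : M ∈ K.carrier) : ∃ L ∈ K.carrier, L ≤ N ∧ L ≤ M := by
  have := K.normal hN
  have := K.normal hM
  obtain ⟨a, ha⟩ := K.index_eq N hN
  obtain ⟨b, hb⟩ := K.index_eq M hM
  obtain ⟨L, hL, hle⟩ := K.exhausting (N ⊓ M) inferInstance (by
    have h1 : (N ⊓ M).index ∣ p ^ (a + b) := by
      rw [← Subgroup.relIndex_mul_index (inf_le_right : N ⊓ M ≤ M), Subgroup.inf_relIndex_right,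
        pow_add, ← ha, ← hb]
      exact Nat.mul_dvd_mul_right (Subgroup.relIndex_dvd_index_of_normal N M) _
    obtain ⟨k, -, hk⟩ := (Nat.dvd_prime_pow hp).mp h1
    exact ⟨k, hk⟩)
  exact ⟨L, hL, hle.trans inf_le_left, hle.trans inf_le_right⟩

/-- Finite-index subgroups of a finitely generated group are finitely generated. Countability yields
a cofinal sequence, along which sections can be composed recursively. -/
theorem PCoverSystem.countable [Countable G] [Group.FG G] (hp : p.Prime) (K : PCoverSystem G p) :
    K.carrier.Countable := by
  refine (Set.countable_range fun s : Finset G => Subgroup.closure (s : Set G)).mono ?_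
  intro N hN
  have := K.finiteIndex hp hN
  have hfg : N.FG := (Group.fg_iff_subgroup_fg N).mp (Subgroup.fg_of_index_ne_zero N)
  obtain ⟨s, hs⟩ := hfg
  exact ⟨s, hs⟩

/-- A cofinal descending sequence in an exhausting system. -/
theorem PCoverSystem.exists_chain [Countable G] [Group.FG G] (hp : p.Prime) (K : PCoverSystem G p)
    (N : K.carrier) : ∃ C : ℕ → K.carrier, C 0 = N ∧
      (∀ i, (C (i + 1) : Subgroup G) ≤ C i) ∧ ∀ M : K.carrier, ∃ i, (C i : Subgroup G) ≤ M := by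
  have : Countable K.carrier := K.countable hp
  have : Nonempty K.carrier := ⟨N⟩
  obtain ⟨e, he⟩ := exists_surjective_nat K.carrier
  choose L hL hL1 hL2 using fun (A B : K.carrier) => K.directed hp A.2 B.2
  let C : ℕ → K.carrier := fun i => Nat.rec N (fun i A => ⟨L A (e i), hL A (e i)⟩) i
  refine ⟨C, rfl, fun i => hL1 _ _, fun M => ?_⟩
  obtain ⟨i, rfl⟩ := he M
  exact ⟨i + 1, hL2 _ _⟩

/-- The projections of the pro-`p` homology have equivariant sections. -/
theorem exists_proH_section [Countable G] [Group.FG G] (hp : p.Prime) (K : PCoverSystem G p)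
    (N : K.carrier) : ∃ s : H1 (N : Subgroup G) →ₗ[ℂ] ProH K,
      (∀ g x, s (conjRep N.1 (K.characteristic N.1 N.2) g x) = deckRep K g (s x)) ∧
      ∀ x, (s x).1 N = x := by
  obtain ⟨C, hC0, hC, hcof⟩ := K.exists_chain hp N
  have hanti : ∀ i j, i ≤ j → (C j : Subgroup G) ≤ C i := fun i j h =>
    antitone_nat_of_succ_le (f := fun i => (C i : Subgroup G)) hC h
  have hch := fun i => K.characteristic _ (C i).2
  have hsec : ∀ i, ∃ s : H1 (C i : Subgroup G) →ₗ[ℂ] H1 (C (i + 1) : Subgroup G),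
      (∀ g w, s (conjRep _ (hch i) g w) = conjRep _ (hch (i + 1)) g (s w)) ∧
      ∀ w, H1.map (Subgroup.inclusion (hC i)) (s w) = w := fun i => by
    have := K.finiteIndex hp (C (i + 1)).2
    have := K.normal (C (i + 1)).2
    exact exists_equivariant_section (C (i + 1)).1 _ _ (fun g hg => conjRep_eq_one _ _ hg)
      (fun g hg => conjRep_eq_one _ _ (hC i hg)) _ (map_inclusion_conjRep (hC i) _ _)
      (H1.map_inclusion_surjective (hC i))
  choose s hs1 hs2 using hsec
  subst hC0
  let t : ∀ i, H1 (C 0 : Subgroup G) →ₗ[ℂ] H1 (C i : Subgroup G) := fun i =>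
    Nat.rec LinearMap.id (fun i t => (s i).comp t) i
  have ht0 : ∀ x, t 0 x = x := fun x => rfl
  have hts : ∀ i x, t (i + 1) x = s i (t i x) := fun i x => rfl
  have htg : ∀ i g x, t i (conjRep _ (hch 0) g x) = conjRep _ (hch i) g (t i x) := fun i g x => by
    induction i with
    | zero => rfl
    | succ i ih => rw [hts, ih, hs1, hts]
  have htm : ∀ i j (h : i ≤ j) x, H1.map (Subgroup.inclusion (hanti i j h)) (t j x) = t i x := by
    intro i j h x
    induction j, h using Nat.le_induction with
    | base => exact DFunLike.congr_fun (H1.map_id _) _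
    | succ j h ih =>
      rw [← ih, ← hs2 j (t j x), map_inclusion_map_inclusion, hts]
  -- The component at `M` may be computed from any member of the chain contained in `M`; this makes
  -- the family compatible.
  have hwd : ∀ (M : K.carrier) i j (hi : (C i : Subgroup G) ≤ M) (hj : (C j : Subgroup G) ≤ M) x,
      H1.map (Subgroup.inclusion hi) (t i x) = H1.map (Subgroup.inclusion hj) (t j x) := by
    intro M i j hi hj x
    rcases le_total i j with h | h
    · rw [← htm i j h, map_inclusion_map_inclusion]
    · rw [← htm j i h, map_inclusion_map_inclusion]
  choose I hI using hcof
  let S : H1 (C 0 : Subgroup G) →ₗ[ℂ] ProH K :=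
    { toFun := fun x => ⟨fun M => H1.map (Subgroup.inclusion (hI M)) (t (I M) x), by
        intro L M h
        rw [map_inclusion_map_inclusion]
        exact hwd M _ _ _ _ x⟩
      map_add' := fun x y => by
        ext M
        simp
      map_smul' := fun c x => by
        ext M
        simp }
  refine ⟨S, fun g x => Subtype.ext (funext fun M => ?_), fun x => ?_⟩
  · change H1.map (Subgroup.inclusion (hI M)) (t (I M) _) =
      conjRep M.1 (K.characteristic M.1 M.2) g (H1.map (Subgroup.inclusion (hI M)) (t (I M) x))
    rw [htg, map_inclusion_conjRep]
  · exact hwd (C 0) _ 0 _ le_rfl x |>.trans (DFunLike.congr_fun (H1.map_id _) _)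

end Cover

/-! ### Deck characters of free groups -/

section DeckCharacters

variable {α : Type} [Finite α] {p : ℕ}

/-- Every irreducible representation of a deck group of a free group of rank at least two is a
quotient of `H₁` of the cover. -/
theorem exists_surjective_conjRep (hα : 2 ≤ Nat.card α) {V : Type} [AddCommGroup V] [Module ℂ V]
    [FiniteDimensional ℂ V] {ρ : Representation ℂ (FreeGroup α) V} (hρ : ρ.IsIrreducible)
    (N : Subgroup (FreeGroup α)) (hN : N.Characteristic) [N.FiniteIndex]
    (hNρ : ∀ g ∈ N, ρ g = 1) :
    ∃ T : H1 N →ₗ[ℂ] V, (∀ g x, T (conjRep N hN g x) = ρ g (T x)) ∧ Function.Surjective T := by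
  obtain ⟨hV, hirr⟩ := (isIrreducible_iff ρ).mp hρ
  have : Fintype α := Fintype.ofFinite α
  obtain ⟨d, hd, n₀, hn₀, hdn⟩ : ∃ d : FreeGroup α → V, (∀ g h, d (g * h) = d g + ρ g (d h)) ∧
      ∃ n ∈ N, d n ≠ 0 := by
    -- Otherwise every derivation is inner, so `w ↦ (ρ(a) w - w)_a` maps `V` onto `V^α`, which is
    -- impossible with at least two generators since `V ≠ 0`.
    by_contra! hcon
    let E : V →ₗ[ℂ] (α → V) := LinearMap.pi fun a => ρ (FreeGroup.of a) - LinearMap.id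
    have hE : Function.Surjective E := fun v => by
      obtain ⟨d, hd, hdv⟩ := exists_derivation ρ v
      obtain ⟨w, hw⟩ := exists_inner_of_derivation N ρ d hd (hcon d hd)
      exact ⟨w, funext fun a => by rw [← hdv a, hw]; rfl⟩
    have h1 := LinearMap.finrank_le_finrank_of_surjective hE
    rw [Module.finrank_pi_fintype, Finset.sum_const, Finset.card_univ, smul_eq_mul,
      ← Nat.card_eq_fintype_card] at h1
    have h2 : 0 < Module.finrank ℂ V := Module.finrank_pos
    nlinarith
  have hd1 : d 1 = 0 := by simpa using hd 1 1
  obtain ⟨T, hT⟩ := H1.exists_lift (fun x : N => d x) fun x y => by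
    rw [Subgroup.coe_mul, hd, hNρ x x.2, Module.End.one_apply]
  have hTg : ∀ g x, T (conjRep N hN g x) = ρ g (T x) := fun g => by
    have : T.comp (conjRep N hN g) = (ρ g).comp T := H1.hom_ext fun x => by
      rw [LinearMap.comp_apply, LinearMap.comp_apply, conjRep_cls, hT, hT]
      change d (g * x * g⁻¹) = _
      have h1 := hd g g⁻¹
      rw [mul_inv_cancel, hd1] at h1
      rw [hd, hd, map_mul, hNρ x x.2, mul_one, add_right_comm, ← h1, zero_add]
    exact fun x => DFunLike.congr_fun this x
  refine ⟨T, hTg, ?_⟩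
  rw [← LinearMap.range_eq_top]
  refine (hirr (LinearMap.range T) ?_).resolve_left fun h => hdn ?_
  · rintro g _ ⟨x, rfl⟩
    exact ⟨_, hTg g x⟩
  · have h1 : T (H1.cls ⟨n₀, hn₀⟩) ∈ LinearMap.range T := ⟨_, rfl⟩
    rw [h, Submodule.mem_bot, hT] at h1
    exact h1

/-- The quotient `V` of `H₁(N; ℂ)` is a direct summand by complete reducibility, and `H₁(N; ℂ)`
embeds into the limit by a section of the projection. -/
theorem isDeckCharacter_of_isIrreducible (hα : 2 ≤ Nat.card α) (hp : p.Prime)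
    (K : PCoverSystem (FreeGroup α) p) {V : Type} [AddCommGroup V] [Module ℂ V]
    [FiniteDimensional ℂ V] {ρ : Representation ℂ (FreeGroup α) V} (hρ : ρ.IsIrreducible)
    {N : Subgroup (FreeGroup α)} (hN : N ∈ K.carrier) (hNρ : ∀ g ∈ N, ρ g = 1) :
    IsDeckCharacter K ρ.character := by
  have := K.finiteIndex hp hN
  obtain ⟨T, hT, hTs⟩ := exists_surjective_conjRep hα hρ N (K.characteristic N hN) hNρ
  obtain ⟨j, hj, hTj⟩ := exists_equivariant_section N _ ρ
    (fun g hg => conjRep_eq_one N _ hg) hNρ T hT hTs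
  have : Countable (FreeGroup α) := by
    classical
    exact FreeGroup.toWord_injective.countable
  obtain ⟨s, hs, hsN⟩ := exists_proH_section hp K ⟨N, hN⟩
  refine ⟨V, _, _, inferInstance, ρ, s.comp j, hρ, ⟨N, hN, hNρ⟩, ?_, fun g v => ?_, rfl⟩
  · intro v w h
    have h1 := congrArg (fun x : ProH K => x.1 ⟨N, hN⟩) h
    simp only [LinearMap.comp_apply, hsN] at h1
    rw [← hTj v, h1, hTj]
  · rw [LinearMap.comp_apply, LinearMap.comp_apply, hj, hs]

theorem IsDeckCharacter.eq_of_isConj {G : Type} [Group G] {K : PCoverSystem G p} {χ : G → ℂ}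
    (hχ : IsDeckCharacter K χ) {g h : G} (hgh : IsConj g h) : χ g = χ h := by
  obtain ⟨V, _, _, _, ρ, -, -, -, -, -, rfl⟩ := hχ
  obtain ⟨c, rfl⟩ := isConj_iff.mp hgh
  exact (ρ.char_conj g c).symm

/-- The deck characters of a free group of rank at least two separate its conjugacy classes. -/
theorem isConj_iff_deckCharacter (hα : 2 ≤ Nat.card α) (hp : p.Prime)
    (K : PCoverSystem (FreeGroup α) p) (g h : FreeGroup α) :
    IsConj g h ↔ ∀ χ, IsDeckCharacter K χ → χ g = χ h := by
  refine ⟨fun hgh χ hχ => hχ.eq_of_isConj hgh, fun hχ => ?_⟩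
  by_contra hgh
  have : Fact p.Prime := ⟨hp⟩
  obtain ⟨Q, _, _, hQ, f, hf⟩ := exists_pGroup_not_isConj (p := p) hgh
  obtain ⟨N, hN, hNf⟩ := K.exhausting f.ker inferInstance (by
    rw [Subgroup.index_ker]
    exact IsPGroup.iff_card.mp (hQ.to_subgroup f.range))
  have := K.normal hN
  have := K.finiteIndex hp hN
  have : Fintype (FreeGroup α ⧸ N) := Subgroup.fintypeQuotientOfFiniteIndex
  have hne : ¬ IsConj (QuotientGroup.mk' N g) (QuotientGroup.mk' N h) := fun hc => by
    have := (QuotientGroup.lift N f hNf).map_isConj hc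
    exact hf this
  obtain ⟨V, _, _, _, ρ, hρ, hχρ⟩ := exists_irreducible_character_ne hne
  let ρ' : Representation ℂ (FreeGroup α) V := ρ.comp (QuotientGroup.mk' N)
  refine hχρ (hχ ρ'.character
    (isDeckCharacter_of_isIrreducible (ρ := ρ') hα hp K ?_ hN fun x hx => ?_))
  · rw [isIrreducible_iff] at hρ ⊢
    refine ⟨hρ.1, fun W hW => hρ.2 W fun q v hv => ?_⟩
    obtain ⟨x, rfl⟩ := QuotientGroup.mk'_surjective N q
    exact hW x v hv
  · change ρ (QuotientGroup.mk' N x) = 1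
    rw [QuotientGroup.mk'_apply, (QuotientGroup.eq_one_iff x).mpr hx, map_one]

end DeckCharacters

end FreeGroupDetection

end

namespace FreeGroupDetection

/-! ### Arrows of free groupoids -/

section FreeGroupoids

open CategoryTheory Quiver

variable {V : Type} [Quiver.{1} V]

theorem lift_map_of {C : Type*} [Groupoid C] (φ : V ⥤q C) {a b : V} (e : a ⟶ b) :
    (FreeGroupoid.lift φ).map ((FreeGroupoid.of V).map e) = φ.map e :=
  Category.id_comp _

theorem map_groupoid_inv {C D : Type*} [Groupoid C] [Groupoid D] (F : C ⥤ D) {a b : C}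
    (q : a ⟶ b) : F.map (Groupoid.inv q) = Groupoid.inv (F.map q) := by
  rw [Groupoid.inv_eq_inv, Groupoid.inv_eq_inv, Functor.map_inv]

theorem conj_conj_cancel {C : Type*} [Groupoid C] {a b : C} (u w : a ⟶ a) (s : a ⟶ b) :
    (Groupoid.inv u ≫ s) ≫ (Groupoid.inv s ≫ ((u ≫ w) ≫ Groupoid.inv u) ≫ s) ≫
      Groupoid.inv (Groupoid.inv u ≫ s) = w := by
  simp

theorem freeGroupoid_induction {P : ∀ {x y : Quiver.FreeGroupoid V}, (x ⟶ y) → Prop}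
    (id : ∀ x : Quiver.FreeGroupoid V, P (𝟙 x))
    (comp_edge : ∀ (x : Quiver.FreeGroupoid V) {a b : V} (q : x ⟶ (FreeGroupoid.of V).obj a)
      (e : a ⟶ b), P q → P (q ≫ (FreeGroupoid.of V).map e))
    (comp_inv_edge : ∀ (x : Quiver.FreeGroupoid V) {a b : V}
      (q : x ⟶ (FreeGroupoid.of V).obj b) (e : a ⟶ b), P q →
      P (q ≫ Groupoid.inv ((FreeGroupoid.of V).map e)))
    {x y : Quiver.FreeGroupoid V} (q : x ⟶ y) : P q := by
  have key : ∀ {a b : Quiver.Symmetrify V} (p : Quiver.Path a b),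
      P (x := (FreeGroupoid.of V).obj a) (y := (FreeGroupoid.of V).obj b) (Quot.mk _ p) := by
    intro a b p
    induction p with
    | nil => exact id _
    | cons p e ih =>
      rcases e with e | e
      · exact comp_edge _ _ e ih
      · exact comp_inv_edge _ _ e ih
  obtain ⟨p, rfl⟩ := Quot.exists_rep q
  exact key p

/-- Multiplicative labels of arrows are determined by arbitrary labels of the edges. -/
theorem exists_labelling {H : Type*} [Group H] (l : ∀ {a b : V}, (a ⟶ b) → H) :
    ∃ Λ : ∀ {x y : Quiver.FreeGroupoid V}, (x ⟶ y) → H, (∀ x, Λ (𝟙 x) = 1) ∧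
      (∀ {x y z} (q : x ⟶ y) (r : y ⟶ z), Λ (q ≫ r) = Λ q * Λ r) ∧
      (∀ {x y} (q : x ⟶ y), Λ (Groupoid.inv q) = (Λ q)⁻¹) ∧
      ∀ {a b : V} (e : a ⟶ b), Λ ((FreeGroupoid.of V).map e) = l e := by
  -- Composition in `SingleObj H` is multiplication in reverse order; the inverses yield labels that
  -- multiply along paths.
  let φ : V ⥤q CategoryTheory.SingleObj H :=
    { obj := fun _ => CategoryTheory.SingleObj.star H, map := fun e => (l e)⁻¹ }
  let Φ := FreeGroupoid.lift φ
  have hid : ∀ x, (Φ.map (𝟙 x) : H)⁻¹ = 1 := fun x => by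
    rw [Φ.map_id]
    exact inv_one
  have hcomp : ∀ {x y z : Quiver.FreeGroupoid V} (q : x ⟶ y) (r : y ⟶ z),
      (Φ.map (q ≫ r) : H)⁻¹ = (Φ.map q : H)⁻¹ * (Φ.map r : H)⁻¹ := fun q r => by
    rw [Φ.map_comp, ← mul_inv_rev]
    rfl
  refine ⟨fun q => (Φ.map q : H)⁻¹, hid, hcomp, fun {x y} q => ?_, fun e => ?_⟩
  · rw [eq_inv_iff_mul_eq_one, ← hcomp, Groupoid.inv_comp]
    exact hid y
  · change (Φ.map ((FreeGroupoid.of V).map e) : H)⁻¹ = _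
    rw [lift_map_of]
    exact inv_inv _

/-- Labels of edges by loops which come from paths to the vertices determine the arrows. -/
theorem eq_of_labelling {H : Type*} [Group H] (l : ∀ {a b : V}, (a ⟶ b) → H)
    (Λ : ∀ {x y : Quiver.FreeGroupoid V}, (x ⟶ y) → H) (hid : ∀ x, Λ (𝟙 x) = 1)
    (hcomp : ∀ {x y z} (q : x ⟶ y) (r : y ⟶ z), Λ (q ≫ r) = Λ q * Λ r)
    (hinv : ∀ {x y} (q : x ⟶ y), Λ (Groupoid.inv q) = (Λ q)⁻¹)
    (hedge : ∀ {a b : V} (e : a ⟶ b), Λ ((FreeGroupoid.of V).map e) = l e)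
    {r : Quiver.FreeGroupoid V} (δ : ∀ x, r ⟶ x) (Θ : H →* (r ⟶ r))
    (hΘ : ∀ {a b : V} (e : a ⟶ b), Θ (l e) = δ _ ≫ (FreeGroupoid.of V).map e ≫
      Groupoid.inv (δ _)) {x y : Quiver.FreeGroupoid V} (q : x ⟶ y) :
    Θ (Λ q) = δ x ≫ q ≫ Groupoid.inv (δ y) := by
  have hmul : ∀ h h' : H, Θ (h * h') = Θ h ≫ Θ h' := fun h h' => Θ.map_mul h h'
  have hΘinv : ∀ h : H, Θ h⁻¹ = Groupoid.inv (Θ h) := fun h => Θ.map_inv h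
  have hone : Θ 1 = 𝟙 r := Θ.map_one
  refine freeGroupoid_induction (P := fun {x y} q => Θ (Λ q) = δ x ≫ q ≫ Groupoid.inv (δ y))
    (fun x => ?_) (fun x a b q e hq => ?_) (fun x a b q e hq => ?_) q
  · rw [hid, hone]
    simp
  · rw [hcomp, hmul, hq, hedge, hΘ]
    simp
  · rw [hcomp, hmul, hq, hinv, hΘinv, hedge, hΘ]
    simp

end FreeGroupoids

/-! ### Bases adapted to free factor systems -/

section AdaptedBasis

open Monoid

/-- A free factor system of a free group is given by disjoint subsets of a basis. -/
theorem exists_adapted_basis {α : Type} {k : ℕ} {A : Fin (k + 1) → Subgroup (FreeGroup α)}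
    (hA : IsFreeFactorSystem A) :
    ∃ (X : Fin (k + 1) → Type) (Y : Type) (E : FreeGroup ((Σ i, X i) ⊕ Y) ≃* FreeGroup α),
      (∀ i, A i = (letterSubgroup (Set.range fun x : X i => Sum.inl ⟨i, x⟩)).map E.toMonoidHom) ∧
      (∀ i, Nonempty (X i)) ∧ ((∃ i j : Fin (k + 1), i ≠ j) ∨ Nonempty Y) := by
  obtain ⟨hA1, B, hB⟩ := hA
  -- The factors are free by the Nielsen–Schreier theorem, and the union of their bases is a basis
  -- of the free product.
  let X : Fin (k + 1) → Type := fun i => IsFreeGroup.Generators (A i)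
  let Y : Type := IsFreeGroup.Generators B
  let eX : ∀ i, FreeGroup (X i) ≃* A i := fun i => (IsFreeGroup.toFreeGroup (A i)).symm
  let eY : FreeGroup Y ≃* B := (IsFreeGroup.toFreeGroup B).symm
  let L : FreeGroup ((Σ i, X i) ⊕ Y) →* Coprod (CoprodI fun i => A i) B :=
    FreeGroup.lift (Sum.elim
      (fun x => Coprod.inl (CoprodI.of (i := x.1) (eX x.1 (FreeGroup.of x.2))))
      (fun y => Coprod.inr (eY (FreeGroup.of y))))
  let R : Coprod (CoprodI fun i => A i) B →* FreeGroup ((Σ i, X i) ⊕ Y) :=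
    Coprod.lift (CoprodI.lift fun i =>
      (FreeGroup.map fun x : X i => (Sum.inl ⟨i, x⟩ : (Σ i, X i) ⊕ Y)).comp
        (eX i).symm.toMonoidHom)
      ((FreeGroup.map Sum.inr).comp eY.symm.toMonoidHom)
  have hRL : R.comp L = MonoidHom.id _ := by
    ext (⟨i, x⟩ | y)
    · simp [L, R]
    · simp [L, R]
  have hLX : ∀ i (w : FreeGroup (X i)), L (FreeGroup.map (fun x => Sum.inl ⟨i, x⟩) w) =
      Coprod.inl (CoprodI.of (M := fun j => ↥(A j)) (i := i) (eX i w)) := fun i w => by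
    have : L.comp (FreeGroup.map fun x : X i => (Sum.inl ⟨i, x⟩ : (Σ i, X i) ⊕ Y)) =
        Coprod.inl.comp ((CoprodI.of (M := fun j => ↥(A j)) (i := i)).comp (eX i).toMonoidHom) := by
      ext x
      simp [L]
    exact DFunLike.congr_fun this w
  have hLY : ∀ w : FreeGroup Y, L (FreeGroup.map Sum.inr w) = Coprod.inr (eY w) := fun w => by
    have : L.comp (FreeGroup.map (Sum.inr : Y → (Σ i, X i) ⊕ Y)) =
        Coprod.inr.comp eY.toMonoidHom := by
      ext x
      simp [L]
    exact DFunLike.congr_fun this w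
  have hLR : L.comp R = MonoidHom.id _ := by
    refine Coprod.hom_ext (CoprodI.ext_hom _ _ fun i => ?_) ?_
    · ext a
      simp [R, hLX]
    · ext b
      simp [R, hLY]
  let E₁ : FreeGroup ((Σ i, X i) ⊕ Y) ≃* Coprod (CoprodI fun i => A i) B :=
    MonoidHom.toMulEquiv L R hRL hLR
  let E₂ := MulEquiv.ofBijective _ hB
  let E := E₁.trans E₂
  have hEX : ∀ i (w : FreeGroup (X i)), E (FreeGroup.map (fun x => Sum.inl ⟨i, x⟩) w) = eX i w :=
    fun i w => by
      change E₂ (L _) = _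
      rw [hLX]
      simp [E₂]
  have hEA : ∀ i, A i =
      (letterSubgroup (Set.range fun x : X i => Sum.inl ⟨i, x⟩)).map E.toMonoidHom := fun i => by
    have h1 : letterSubgroup (Set.range fun x : X i => (Sum.inl ⟨i, x⟩ : (Σ i, X i) ⊕ Y)) =
        (FreeGroup.map fun x : X i => (Sum.inl ⟨i, x⟩ : (Σ i, X i) ⊕ Y)).range := by
      rw [letterSubgroup, ← Set.range_comp, MonoidHom.range_eq_map, ← FreeGroup.closure_range_of,
        MonoidHom.map_closure, ← Set.range_comp]
      rfl
    rw [h1]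
    ext a
    constructor
    · intro ha
      refine ⟨_, ⟨(eX i).symm ⟨a, ha⟩, rfl⟩, ?_⟩
      change E _ = a
      rw [hEX]
      simp
    · rintro ⟨_, ⟨w, rfl⟩, rfl⟩
      change E _ ∈ _
      rw [hEX]
      exact (eX i w).2
  refine ⟨X, Y, E, hEA, fun i => ?_, ?_⟩
  · by_contra hX
    rw [not_nonempty_iff] at hX
    apply (hA1 i).1
    rw [hEA i, Set.range_eq_empty, letterSubgroup, Set.image_empty, Subgroup.closure_empty,
      Subgroup.map_bot]
  · by_contra! hcon
    obtain ⟨hk, hY⟩ := hcon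
    apply (hA1 0).2
    have : Set.range (fun x : X 0 => (Sum.inl ⟨0, x⟩ : (Σ i, X i) ⊕ Y)) = Set.univ := by
      rw [Set.eq_univ_iff_forall]
      rintro (⟨i, x⟩ | y)
      · obtain rfl := hk i 0
        exact ⟨x, rfl⟩
      · exact isEmptyElim y
    rw [hEA 0, this, letterSubgroup, Set.image_univ, FreeGroup.closure_range_of]
    exact Subgroup.map_top_of_surjective _ E.surjective

/-- Free groups of rank at most one have no free factor systems. -/
theorem two_le_of_isFreeFactorSystem {n k : ℕ} {A : Fin (k + 1) → Subgroup (FreeGroup (Fin n))}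
    (hA : IsFreeFactorSystem A) : 2 ≤ n := by
  obtain ⟨X, Y, E, -, hX, hY⟩ := exists_adapted_basis hA
  let e : (Σ i, X i) ⊕ Y ≃ Fin n := Equiv.ofFreeGroupEquiv E
  have hnt : Nontrivial ((Σ i, X i) ⊕ Y) := by
    rcases hY with ⟨i, j, hij⟩ | ⟨⟨y⟩⟩
    · refine ⟨Sum.inl ⟨i, (hX i).some⟩, Sum.inl ⟨j, (hX j).some⟩, fun h => hij ?_⟩
      exact congrArg Sigma.fst (Sum.inl_injective h)
    · exact ⟨Sum.inl ⟨0, (hX 0).some⟩, Sum.inr y, Sum.inl_ne_inr⟩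
  have := e.nontrivial_congr.mp hnt
  exact Fin.nontrivial_iff_two_le.mp this

end AdaptedBasis

end FreeGroupDetection

noncomputable section

namespace FreeGroupDetection

/-! ### Free factor systems give reducible graph maps -/

section Star

open CategoryTheory Quiver

/-- The vertices of the star graph: roses with petals `X i` at the tips of a star, whose center
carries a rose with petals `Y`. -/
inductive StarVertex {ι : Type} (X : ι → Type) (Y : Type) : Type
  | center : StarVertex X Y
  | tip (i : ι) : StarVertex X Y

/-- The edges of the star graph. -/
inductive StarEdge {ι : Type} (X : ι → Type) (Y : Type) :
    StarVertex X Y → StarVertex X Y → Type 1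
  | loop (y : Y) : StarEdge X Y .center .center
  | stem (i : ι) : StarEdge X Y .center (.tip i)
  | petal (i : ι) (x : X i) : StarEdge X Y (.tip i) (.tip i)

variable {ι : Type} {X : ι → Type} {Y : Type}

instance : Quiver.{1} (StarVertex X Y) := ⟨StarEdge X Y⟩

/-- The petals at the tips of the star. -/
inductive IsPetal : ∀ a b : StarVertex X Y, (a ⟶ b) → Prop
  | mk (i : ι) (x : X i) : IsPetal _ _ (StarEdge.petal i x)

theorem finite_starVertex [Finite ι] : Finite (StarVertex X Y) := by
  refine Finite.of_surjective (fun o : Option ι => o.elim StarVertex.center StarVertex.tip) ?_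
  rintro (_ | i)
  exacts [⟨none, rfl⟩, ⟨some i, rfl⟩]

theorem finite_starEdge [Finite ι] [Finite ((Σ i, X i) ⊕ Y)] (a b : StarVertex X Y) :
    Finite (a ⟶ b) := by
  let f : ∀ {a b : StarVertex X Y}, StarEdge X Y a b → ι ⊕ ((Σ i, X i) ⊕ Y)
    | _, _, .loop y => Sum.inr (Sum.inr y)
    | _, _, .stem i => Sum.inl i
    | _, _, .petal i x => Sum.inr (Sum.inl ⟨i, x⟩)
  have hf : ∀ {a b : StarVertex X Y} (e e' : StarEdge X Y a b), f e = f e' → e = e' := by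
    intro a b e e' h
    cases e <;> cases e' <;> simp_all [f]
  exact Finite.of_injective (fun e : StarEdge X Y a b => f e) fun e e' h => hf e e' h

/-- The vertices of the fundamental groupoid of the star graph. -/
abbrev starOb (a : StarVertex X Y) : Quiver.FreeGroupoid (StarVertex X Y) :=
  (Quiver.FreeGroupoid.of _).obj a

/-- The arrow given by an edge of the star graph. -/
abbrev starArrow {a b : StarVertex X Y} (e : StarEdge X Y a b) : starOb a ⟶ starOb b :=
  (Quiver.FreeGroupoid.of _).map (show a ⟶ b from e)

/-- The path from the center along the star. -/
def starPath : ∀ a : StarVertex X Y, starOb .center ⟶ starOb a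
  | .center => 𝟙 _
  | .tip i => starArrow (.stem i)

/-- The marking of the star graph. -/
def starMarking :
    FreeGroup ((Σ i, X i) ⊕ Y) →* (starOb (.center : StarVertex X Y) ⟶ starOb .center) :=
  FreeGroup.lift (Sum.elim
    (fun x => starArrow (.stem x.1) ≫ starArrow (.petal x.1 x.2) ≫
      Groupoid.inv (starArrow (.stem x.1)))
    (fun y => starArrow (.loop y)))

theorem starMarking_inl (i : ι) (x : X i) :
    starMarking (Y := Y) (FreeGroup.of (Sum.inl ⟨i, x⟩)) = starArrow (.stem i) ≫
      starArrow (.petal i x) ≫ Groupoid.inv (starArrow (.stem i)) := by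
  simp [starMarking]

theorem starMarking_inr (y : Y) :
    starMarking (X := X) (FreeGroup.of (Sum.inr y)) = starArrow (.loop y) := by
  simp [starMarking]

theorem starMarking_mul (v w : FreeGroup ((Σ i, X i) ⊕ Y)) :
    starMarking (v * w) = starMarking v ≫ starMarking w := map_mul _ _ _

theorem starMarking_inv (w : FreeGroup ((Σ i, X i) ⊕ Y)) :
    starMarking w⁻¹ = Groupoid.inv (starMarking w) := map_inv _ _

/-- The element of the free group read along an edge of the star graph. -/
def starLabel : ∀ {a b : StarVertex X Y}, StarEdge X Y a b → FreeGroup ((Σ i, X i) ⊕ Y)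
  | _, _, .loop y => FreeGroup.of (Sum.inr y)
  | _, _, .stem _ => 1
  | _, _, .petal i x => FreeGroup.of (Sum.inl ⟨i, x⟩)

theorem starMarking_starLabel {a b : StarVertex X Y} (e : StarEdge X Y a b) :
    starMarking (starLabel e) = starPath a ≫ starArrow e ≫ Groupoid.inv (starPath b) := by
  cases e with
  | loop y =>
    rw [starLabel, starMarking_inr]
    simp [starPath]
  | stem i =>
    rw [starLabel, map_one]
    simp [starPath]
  | petal i x =>
    rw [starLabel, starMarking_inl]
    rfl

/-- The stems form a spanning tree labelled by `1`, so reading labels along loops inverts the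
marking. -/
theorem starMarking_bijective : Function.Bijective (starMarking (X := X) (Y := Y)) := by
  obtain ⟨Λ, hid, hcomp, hinv, hedge⟩ := exists_labelling (V := StarVertex X Y)
    (H := FreeGroup ((Σ i, X i) ⊕ Y)) (fun e => starLabel e)
  have hedge' : ∀ {a b : StarVertex X Y} (e : StarEdge X Y a b),
      Λ (starArrow e) = starLabel e := fun e => hedge (show _ ⟶ _ from e)
  constructor
  · let Λ' : (starOb (.center : StarVertex X Y) ⟶ starOb .center) →*
      FreeGroup ((Σ i, X i) ⊕ Y) := MonoidHom.mk' (fun q => Λ q) hcomp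
    have h : Λ'.comp starMarking = MonoidHom.id _ := by
      ext (⟨i, x⟩ | y)
      · change Λ (starMarking _) = _
        rw [starMarking_inl, hcomp, hcomp, hinv, hedge', hedge']
        simp [starLabel]
      · change Λ (starMarking _) = _
        rw [starMarking_inr, hedge']
        rfl
    exact Function.LeftInverse.injective (g := Λ') fun w => DFunLike.congr_fun h w
  · intro q
    refine ⟨Λ q, (eq_of_labelling (fun e => starLabel e) Λ hid hcomp hinv hedge
      (fun x => starPath x.as) starMarking (fun e => starMarking_starLabel e) q).trans ?_⟩
    change 𝟙 _ ≫ q ≫ Groupoid.inv (𝟙 _) = q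
    simp

variable (σ : ι → ι) (g : ι → FreeGroup ((Σ i, X i) ⊕ Y))
  (ψ : FreeGroup ((Σ i, X i) ⊕ Y) →* FreeGroup ((Σ i, X i) ⊕ Y))

/-- The graph map of the star graph which permutes the tips according to `σ` and induces `ψ`. -/
def starMapOb : StarVertex X Y → StarVertex X Y
  | .center => .center
  | .tip i => .tip (σ i)

/-- The images of the edges under the graph map of the star graph. -/
def starMapEdge : ∀ {a b : StarVertex X Y}, StarEdge X Y a b →
    (starOb (starMapOb σ a) ⟶ starOb (starMapOb σ b))
  | _, _, .loop y => starMarking (ψ (FreeGroup.of (Sum.inr y)))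
  -- The detour along `(g i)⁻¹` lets the petals at a tip go to loops conjugated by `g i`, while the
  -- map induced at the center remains `ψ`.
  | _, _, .stem i => starMarking (g i)⁻¹ ≫ starArrow (.stem (σ i))
  | _, _, .petal i x => Groupoid.inv (starArrow (.stem (σ i))) ≫
      starMarking (g i * ψ (FreeGroup.of (Sum.inl ⟨i, x⟩)) * (g i)⁻¹) ≫ starArrow (.stem (σ i))

/-- The functor of fundamental groupoids induced by the graph map of the star graph. -/
def starFunctor : Quiver.FreeGroupoid (StarVertex X Y) ⥤ Quiver.FreeGroupoid (StarVertex X Y) :=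
  Quiver.FreeGroupoid.lift
    { obj := fun a => starOb (starMapOb σ a), map := fun e => starMapEdge σ g ψ e }

theorem starFunctor_map {a b : StarVertex X Y} (e : StarEdge X Y a b) :
    (starFunctor σ g ψ).map (starArrow e) = starMapEdge σ g ψ e :=
  lift_map_of _ _

theorem starFunctor_marking (w : FreeGroup ((Σ i, X i) ⊕ Y)) :
    (starFunctor σ g ψ).map (starMarking w) = starMarking (ψ w) := by
  let f : (starOb (.center : StarVertex X Y) ⟶ starOb .center) →*
      (starOb (.center : StarVertex X Y) ⟶ starOb .center) :=
    MonoidHom.mk' (fun q => (starFunctor σ g ψ).map q) fun q r => (starFunctor σ g ψ).map_comp q r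
  have h : f.comp starMarking = starMarking.comp ψ := by
    ext (⟨i, x⟩ | y)
    · have h1 : (starFunctor σ g ψ).map (starArrow (.stem i) ≫ starArrow (.petal i x) ≫
          Groupoid.inv (starArrow (.stem i))) = starMapEdge σ g ψ (.stem i) ≫
          starMapEdge σ g ψ (.petal i x) ≫ Groupoid.inv (starMapEdge σ g ψ (.stem i)) := by
        rw [Functor.map_comp, Functor.map_comp, map_groupoid_inv, starFunctor_map,
          starFunctor_map]
        rfl
      have h2 : starMapEdge σ g ψ (.stem i) ≫
          starMapEdge σ g ψ (.petal i x) ≫ Groupoid.inv (starMapEdge σ g ψ (.stem i)) =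
          starMarking (ψ (FreeGroup.of (Sum.inl ⟨i, x⟩))) := by
        simp only [starMapEdge, starMarking_mul, starMarking_inv]
        exact conj_conj_cancel _ _ _
      rw [MonoidHom.comp_apply, starMarking_inl]
      exact h1.trans h2
    · rw [MonoidHom.comp_apply, starMarking_inr]
      exact starFunctor_map σ g ψ (.loop y)
  exact DFunLike.congr_fun h w

theorem starMarking_mem_edgeGroupoid {i : ι} (hX : Nonempty (X i))
    {w : FreeGroup ((Σ i, X i) ⊕ Y)}
    (hw : w ∈ letterSubgroup (Set.range fun x : X i => (Sum.inl ⟨i, x⟩ : (Σ i, X i) ⊕ Y))) :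
    Groupoid.inv (starArrow (.stem i)) ≫ starMarking w ≫ starArrow (.stem i) ∈
      (edgeGroupoid (V := StarVertex X Y) fun a b => {e | IsPetal a b e}).arrows _ _ := by
  have hpetal : ∀ x : X i, starArrow (.petal i x) ∈
      (edgeGroupoid (V := StarVertex X Y) fun a b => {e | IsPetal a b e}).arrows _ _ := fun x =>
    Subgroupoid.subset_generated _ _ _ (IsEdgeOf.edge _ (IsPetal.mk i x))
  refine Subgroup.closure_induction (p := fun w _ =>
    Groupoid.inv (starArrow (.stem i)) ≫ starMarking w ≫ starArrow (.stem i) ∈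
      (edgeGroupoid (V := StarVertex X Y) fun a b => {e | IsPetal a b e}).arrows _ _)
    ?_ ?_ ?_ ?_ hw
  · rintro _ ⟨_, ⟨x, rfl⟩, rfl⟩
    rw [starMarking_inl]
    simpa using hpetal x
  · rw [map_one]
    have : Groupoid.inv (starArrow (.stem i)) ≫
        (1 : starOb (.center : StarVertex X Y) ⟶ starOb .center) ≫
        starArrow (.stem i) = 𝟙 _ := by
      change Groupoid.inv (starArrow (.stem i)) ≫ 𝟙 _ ≫ starArrow (.stem i) = 𝟙 _
      simp
    rw [this]
    exact Subgroupoid.id_mem_of_src _ (hpetal hX.some)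
  · intro v w _ _ hv hw
    have := (edgeGroupoid (V := StarVertex X Y) fun a b => {e | IsPetal a b e}).mul hv hw
    rw [starMarking_mul]
    simpa using this
  · intro v _ hv
    have := (edgeGroupoid (V := StarVertex X Y) fun a b => {e | IsPetal a b e}).inv hv
    rw [starMarking_inv]
    simpa using this

theorem card_ne_one_of_ne {T : Type*} {a b : T} (h : a ≠ b) : Nat.card T ≠ 1 := fun hc =>
  h ((Nat.card_eq_one_iff_unique.mp hc).1.elim a b)

end Star

/-- One conjugator `g i` carries all of `ψ(A i)` into `A (i + 1)`. The star graph map built from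
these conjugators preserves the union of the petals, from which the stems are missing. -/
theorem isReducible_of_isFreeFactorSystem {n k : ℕ} {ψ : MulAut (FreeGroup (Fin n))}
    {A : Fin (k + 1) → Subgroup (FreeGroup (Fin n))} (hA : IsFreeFactorSystem A)
    (hψ : ∀ i, ∀ a ∈ A i, ∃ a' ∈ A (i + 1), IsConj (ψ a) a') : IsReducible ψ := by
  classical
  obtain ⟨X, Y, E, hE, hX, hY⟩ := exists_adapted_basis hA
  have hfin : Finite ((Σ i, X i) ⊕ Y) := Finite.of_equiv _ (Equiv.ofFreeGroupEquiv E).symm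
  let ψ' : FreeGroup ((Σ i, X i) ⊕ Y) →* FreeGroup ((Σ i, X i) ⊕ Y) :=
    E.symm.toMonoidHom.comp (ψ.toMonoidHom.comp E.toMonoidHom)
  have hψ'E : ∀ w, E (ψ' w) = ψ (E w) := fun w => E.apply_symm_apply _
  let P : ∀ i, Subgroup (FreeGroup ((Σ i, X i) ⊕ Y)) := fun i =>
    letterSubgroup (Set.range fun x : X i => (Sum.inl ⟨i, x⟩ : (Σ i, X i) ⊕ Y))
  have hconj : ∀ i, ∃ g, ∀ h ∈ (P i).map ψ', g * h * g⁻¹ ∈ P (i + 1) := fun i => by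
    refine exists_conj_le_letterSubgroup _ ?_
    rintro _ ⟨w, hw, rfl⟩
    obtain ⟨a', ha', hc⟩ := hψ i (E w) (by rw [hE i]; exact ⟨w, hw, rfl⟩)
    rw [hE (i + 1)] at ha'
    obtain ⟨u, hu, rfl⟩ := ha'
    refine ⟨u, hu, ?_⟩
    have := E.symm.toMonoidHom.map_isConj hc
    have h1 : E.symm.toMonoidHom (E.toMonoidHom u) = u := E.symm_apply_apply u
    rw [h1] at this
    exact this
  choose g hg using hconj
  let m : FreeGroup (Fin n) ≃* (starOb (.center : StarVertex X Y) ⟶ starOb .center) :=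
    E.symm.trans (MulEquiv.ofBijective starMarking starMarking_bijective)
  have hm : ∀ w, m w = starMarking (E.symm w) := fun w => rfl
  refine ⟨StarVertex X Y, inferInstance, finite_starVertex, finite_starEdge, starOb .center, m,
    starFunctor (fun i => i + 1) g ψ', CategoryTheory.CategoryStruct.id (starOb .center),
    fun a b => {e | IsPetal a b e}, ?_, ?_, ?_, ?_, ?_, ?_⟩
  · intro a b
    exact ⟨CategoryTheory.CategoryStruct.comp (CategoryTheory.Groupoid.inv (starPath a.as))
      (starPath b.as)⟩
  -- The center has two stems or a loop, and each tip has a petal; a loop contributes two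
  -- half-edges.
  · rintro (_ | i)
    · rcases hY with ⟨i, j, hij⟩ | ⟨⟨y⟩⟩
      · refine card_ne_one_of_ne (a := Sum.inl
            (Sigma.mk (β := fun b => StarEdge X Y _ b) (.tip i) (StarEdge.stem i)))
          (b := Sum.inl
            (Sigma.mk (β := fun b => StarEdge X Y _ b) (.tip j) (StarEdge.stem j)))
          fun h => hij ?_
        have := congrArg Sigma.fst (Sum.inl_injective h)
        exact StarVertex.tip.inj this
      · exact card_ne_one_of_ne (a := Sum.inl
            (Sigma.mk (β := fun b => StarEdge X Y _ b) .center (StarEdge.loop y)))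
          (b := Sum.inr
            (Sigma.mk (β := fun b => StarEdge X Y b _) .center (StarEdge.loop y)))
          Sum.inl_ne_inr
    · exact card_ne_one_of_ne (a := Sum.inl
            (Sigma.mk (β := fun b => StarEdge X Y _ b) (.tip i) (StarEdge.petal i (hX i).some)))
          (b := Sum.inr
            (Sigma.mk (β := fun b => StarEdge X Y b _) (.tip i) (StarEdge.petal i (hX i).some)))
          Sum.inl_ne_inr
  · intro w
    have h1 : E.symm (ψ w) = ψ' (E.symm w) := by
      rw [E.symm_apply_eq, hψ'E, E.apply_symm_apply]
    rw [hm, hm, starFunctor_marking, h1]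
    change _ = CategoryTheory.CategoryStruct.comp (CategoryTheory.CategoryStruct.id (starOb _))
      (CategoryTheory.CategoryStruct.comp _
        (CategoryTheory.Groupoid.inv (CategoryTheory.CategoryStruct.id (starOb _))))
    simp
  · exact ⟨.center, .tip 0, StarEdge.stem 0, fun h => nomatch h⟩
  · obtain ⟨x⟩ := hX 0
    refine ⟨starOb (.tip 0), starArrow (.petal 0 x),
      CategoryTheory.Subgroupoid.subset_generated _ _ _ (IsEdgeOf.edge _ (IsPetal.mk 0 x)),
      fun h => FreeGroup.of_ne_one (Sum.inl ⟨0, x⟩ : (Σ i, X i) ⊕ Y) ?_⟩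
    apply starMarking_bijective.1
    rw [starMarking_inl, h, map_one]
    simp
  · rintro _ _ _ ⟨i, x⟩
    have h1 : (starFunctor (fun i => i + 1) g ψ').map (starArrow (.petal i x)) = _ :=
      starFunctor_map _ _ _ _
    have h2 := starMarking_mem_edgeGroupoid (Y := Y) (hX (i + 1))
      (hg i _ ⟨_, Subgroup.subset_closure ⟨_, ⟨x, rfl⟩, rfl⟩, rfl⟩)
    have h3 : starMapEdge (fun i => i + 1) g ψ' (StarEdge.petal i x) ∈
      (edgeGroupoid (V := StarVertex X Y) fun a b => {e | IsPetal a b e}).arrows _ _ := h2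
    rw [← h1] at h3
    exact h3

end FreeGroupDetection

end

noncomputable section

namespace FreeGroupDetection

/-! ### Spanning trees adapted to a family of components of a subgraph -/

section AdaptedTrees

open CategoryTheory Quiver

variable {V : Type} [Quiver.{1} V]

/-- A vertex as an object of the fundamental groupoid. -/
abbrev vertexOb (a : V) : Quiver.FreeGroupoid V := (Quiver.FreeGroupoid.of V).obj a

/-- An edge as an arrow of the fundamental groupoid. -/
abbrev edgeArrow {a b : V} (e : a ⟶ b) : vertexOb a ⟶ vertexOb b := (Quiver.FreeGroupoid.of V).map e

variable (V) in
/-- The half-edges of a graph, that is the edges with a chosen end. -/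
def HalfEdge : Type 1 := Σ z : V, ((Σ b, (z ⟶ b)) ⊕ (Σ b, (b ⟶ z)))

/-- The other end of a half-edge. -/
def HalfEdge.other : HalfEdge V → V
  | ⟨_, .inl x⟩ => x.1
  | ⟨_, .inr x⟩ => x.1

/-- The edge to which a half-edge belongs. -/
def HalfEdge.edge : HalfEdge V → Σ a b : V, (a ⟶ b)
  | ⟨z, .inl x⟩ => ⟨z, x.1, x.2⟩
  | ⟨z, .inr x⟩ => ⟨x.1, z, x.2⟩

/-- The arrow from the other end of a half-edge. -/
def HalfEdge.arrow : ∀ h : HalfEdge V, (vertexOb h.other ⟶ vertexOb h.1)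
  | ⟨_, .inl x⟩ => Groupoid.inv (edgeArrow x.2)
  | ⟨_, .inr x⟩ => edgeArrow x.2

theorem HalfEdge.eq_or_other_eq {h h' : HalfEdge V} (he : h.edge = h'.edge) :
    h = h' ∨ h'.other = h.1 := by
  obtain ⟨z, ⟨b, e⟩ | ⟨b, e⟩⟩ := h <;> obtain ⟨w, ⟨b', e'⟩ | ⟨b', e'⟩⟩ := h'
  · cases he
    exact Or.inl rfl
  · have he' : (⟨z, b, e⟩ : Σ a b : V, (a ⟶ b)) = ⟨b', w, e'⟩ := he
    cases he'
    exact Or.inr rfl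
  · have he' : (⟨b, z, e⟩ : Σ a b : V, (a ⟶ b)) = ⟨w, b', e'⟩ := he
    cases he'
    exact Or.inr rfl
  · cases he
    exact Or.inl rfl

theorem edgeGroupoid_induction {S : ∀ a b : V, Set (a ⟶ b)}
    (T : Subgroupoid (Quiver.FreeGroupoid V))
    (hT : ∀ (a b : V) (e : a ⟶ b), e ∈ S a b → edgeArrow e ∈ T.arrows _ _)
    {x y : Quiver.FreeGroupoid V} {q : x ⟶ y} (hq : q ∈ (edgeGroupoid S).arrows x y) :
    q ∈ T.arrows x y := by
  have hle : edgeGroupoid S ≤ T := by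
    refine sInf_le ?_
    rintro x y q ⟨e, he⟩
    exact hT _ _ e he
  exact (Subgroupoid.le_iff _ _).mp hle hq

theorem edgeArrow_mem {S : ∀ a b : V, Set (a ⟶ b)} {a b : V} {e : a ⟶ b} (he : e ∈ S a b) :
    edgeArrow e ∈ (edgeGroupoid S).arrows _ _ :=
  Subgroupoid.subset_generated _ _ _ (IsEdgeOf.edge e he)

/-- Two vertices are connected by a nonempty path in the subgraph with edge set `S`. -/
def Joined (S : ∀ a b : V, Set (a ⟶ b)) (a b : V) : Prop :=
  ((edgeGroupoid S).arrows (vertexOb a) (vertexOb b)).Nonempty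

section

variable {S : ∀ a b : V, Set (a ⟶ b)} {a b d : V}

theorem Joined.symm (h : Joined S a b) : Joined S b a := by
  obtain ⟨q, hq⟩ := h
  exact ⟨_, (edgeGroupoid S).inv hq⟩

theorem Joined.trans (h : Joined S a b) (h' : Joined S b d) : Joined S a d := by
  obtain ⟨q, hq⟩ := h
  obtain ⟨q', hq'⟩ := h'
  exact ⟨_, (edgeGroupoid S).mul hq hq'⟩

theorem Joined.of_edge {e : a ⟶ b} (he : e ∈ S a b) : Joined S a b := ⟨_, edgeArrow_mem he⟩

end

variable {ι : Type} (S : ∀ a b : V, Set (a ⟶ b)) (c : ι → V)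

/-- Two vertices are equal or lie in one of the distinguished components of a subgraph. -/
def SameClass (a b : V) : Prop := a = b ∨ ∃ i, Joined S (c i) a ∧ Joined S (c i) b

variable {S c} (hc : ∀ i j, Joined S (c i) (c j) → i = j)

include hc in
theorem sameClass_equivalence : Equivalence (SameClass S c) where
  refl a := Or.inl rfl
  symm := by
    rintro a b (rfl | ⟨i, h, h'⟩)
    exacts [Or.inl rfl, Or.inr ⟨i, h', h⟩]
  trans := by
    rintro a b d (rfl | ⟨i, h, h'⟩) (rfl | ⟨j, g, g'⟩)
    · exact Or.inl rfl
    · exact Or.inr ⟨j, g, g'⟩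
    · exact Or.inr ⟨i, h, h'⟩
    · obtain rfl := hc i j (h'.trans g.symm)
      exact Or.inr ⟨i, h, g'⟩

variable (S c) in
/-- The vertices at distance at most `m` from the class of `r`. -/
def WithinLevel (r : V) : ℕ → V → Prop
  | 0, z => SameClass S c r z
  | m + 1, z => ∃ h : HalfEdge V, SameClass S c h.1 z ∧ WithinLevel r m h.other

include hc in
theorem WithinLevel.of_sameClass {r a b : V} (hab : SameClass S c a b) {m : ℕ}
    (h : WithinLevel S c r m a) : WithinLevel S c r m b := by
  cases m with
  | zero => exact (sameClass_equivalence hc).trans h hab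
  | succ m => exact h.imp fun h ⟨h1, h2⟩ => ⟨(sameClass_equivalence hc).trans h1 hab, h2⟩

theorem exists_withinLevel (r : V)
    (hconn : ∀ a b : Quiver.FreeGroupoid V, Nonempty (a ⟶ b)) (z : V) :
    ∃ m, WithinLevel S c r m z := by
  obtain ⟨q⟩ := hconn (vertexOb r) (vertexOb z)
  refine freeGroupoid_induction
    (P := fun {x y} _ => (∃ m, WithinLevel S c r m x.as) → ∃ m, WithinLevel S c r m y.as)
    (fun x h => h) (fun x a b q e ih h => ?_) (fun x a b q e ih h => ?_) q ⟨0, Or.inl rfl⟩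
  · obtain ⟨m, hm⟩ := ih h
    exact ⟨m + 1, ⟨b, .inr ⟨a, e⟩⟩, Or.inl rfl, hm⟩
  · obtain ⟨m, hm⟩ := ih h
    exact ⟨m + 1, ⟨a, .inl ⟨b, e⟩⟩, Or.inl rfl, hm⟩

include hc in
/-- A spanning tree of the graph of classes: every class except that of `r` is entered through a
half-edge coming from a class closer to `r`. -/
theorem exists_depth_entry (r : V)
    (hconn : ∀ a b : Quiver.FreeGroupoid V, Nonempty (a ⟶ b)) :
    ∃ (depth : V → ℕ) (entry : ∀ z, depth z ≠ 0 → HalfEdge V),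
      (∀ z, depth z = 0 ↔ SameClass S c r z) ∧
      (∀ a b, SameClass S c a b → depth a = depth b) ∧
      (∀ a b ha hb, SameClass S c a b → entry a ha = entry b hb) ∧
      (∀ z hz, SameClass S c (entry z hz).1 z) ∧
      (∀ z hz, depth (entry z hz).other < depth z) := by
  classical
  have hlev := exists_withinLevel (S := S) (c := c) r hconn
  let depth : V → ℕ := fun z => Nat.find (hlev z)
  have hdepth : ∀ a b, SameClass S c a b → depth a = depth b := fun a b hab =>
    le_antisymm (Nat.find_min' _ ((Nat.find_spec (hlev b)).of_sameClass hc
      ((sameClass_equivalence hc).symm hab)))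
      (Nat.find_min' _ ((Nat.find_spec (hlev a)).of_sameClass hc hab))
  have hent : ∀ z, depth z ≠ 0 → ∃ h : HalfEdge V, SameClass S c h.1 z ∧
      depth h.other < depth z := fun z hz => by
    obtain ⟨m, hm⟩ := Nat.exists_eq_succ_of_ne_zero hz
    have h1 : WithinLevel S c r (depth z) z := Nat.find_spec (hlev z)
    rw [hm] at h1
    obtain ⟨h, h2, h3⟩ := h1
    exact ⟨h, h2, by rw [hm]; exact Nat.lt_succ_of_le (Nat.find_min' _ h3)⟩
  choose ent hent1 hent2 using hent
  let st : Setoid V := ⟨SameClass S c, sameClass_equivalence hc⟩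
  let rep : V → V := fun z => (Quotient.mk st z).out
  have hrep : ∀ z, SameClass S c (rep z) z := fun z =>
    Quotient.exact (s := st) (Quotient.out_eq (Quotient.mk st z))
  have hrep' : ∀ a b, SameClass S c a b → rep a = rep b := fun a b hab =>
    congrArg Quotient.out (Quotient.sound (s := st) hab)
  have hrz : ∀ z, depth z ≠ 0 → depth (rep z) ≠ 0 := fun z hz => by rwa [hdepth _ _ (hrep z)]
  refine ⟨depth, fun z hz => ent (rep z) (hrz z hz), fun z => ?_, hdepth, fun a b ha hb hab => ?_,
    fun z hz => ?_, fun z hz => ?_⟩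
  · exact Nat.find_eq_zero _
  · have key : ∀ x y (hx : depth x ≠ 0) (hy : depth y ≠ 0), x = y → ent x hx = ent y hy := by
      rintro x y hx hy rfl
      rfl
    exact key _ _ _ _ (hrep' a b hab)
  · exact (sameClass_equivalence hc).trans (hent1 _ _) (hrep z)
  · rw [← hdepth _ _ (hrep z)]
    exact hent2 _ _

theorem exists_recursion {X : Type*} {T : X → Type*} (depth : X → ℕ) (base : ∀ z, depth z = 0 → T z)
    (par : ∀ z, depth z ≠ 0 → X) (hpar : ∀ z hz, depth (par z hz) < depth z)
    (step : ∀ z hz, T (par z hz) → T z) :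
    ∃ δ : ∀ z, T z, (∀ z hz, δ z = base z hz) ∧ ∀ z hz, δ z = step z hz (δ (par z hz)) := by
  classical
  let F : ∀ z, (∀ y, depth y < depth z → T y) → T z := fun z IH =>
    if hz : depth z = 0 then base z hz else step z hz (IH (par z hz) (hpar z hz))
  let wf := (measure depth).wf
  refine ⟨fun z => wf.fix F z, fun z hz => ?_, fun z hz => ?_⟩
  · change wf.fix F z = _
    rw [wf.fix_eq]
    exact dif_pos hz
  · change wf.fix F z = step z hz (wf.fix F (par z hz))
    rw [wf.fix_eq]
    exact dif_neg hz

include hc in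
/-- Paths from the root along an adapted spanning tree. -/
theorem exists_tree_paths (o : ι)
    (hconn : ∀ a b : Quiver.FreeGroupoid V, Nonempty (a ⟶ b)) (depth : V → ℕ)
    (entry : ∀ z, depth z ≠ 0 → HalfEdge V)
    (h0 : ∀ z, depth z = 0 ↔ SameClass S c (c o) z)
    (hdepth : ∀ a b, SameClass S c a b → depth a = depth b)
    (hentry : ∀ a b ha hb, SameClass S c a b → entry a ha = entry b hb)
    (hsame : ∀ z hz, SameClass S c (entry z hz).1 z)
    (hlt : ∀ z hz, depth (entry z hz).other < depth z) :
    ∃ δ : ∀ z : V, vertexOb (c o) ⟶ vertexOb z, δ (c o) = 𝟙 _ ∧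
      (∀ z hz, δ (entry z hz).1 = δ (entry z hz).other ≫ (entry z hz).arrow) ∧
      ∀ i a b, Joined S (c i) a → Joined S (c i) b →
        Groupoid.inv (δ a) ≫ δ b ∈ (edgeGroupoid S).arrows _ _ := by
  classical
  have hκ : ∀ a b, SameClass S c a b → ∃ κ : vertexOb a ⟶ vertexOb b,
      ∀ i, Joined S (c i) a → Joined S (c i) b → κ ∈ (edgeGroupoid S).arrows _ _ := by
    rintro a b hab
    by_cases h : ∃ i, Joined S (c i) a ∧ Joined S (c i) b
    · obtain ⟨i, hi, hi'⟩ := h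
      obtain ⟨κ, hκ⟩ := hi.symm.trans hi'
      exact ⟨κ, fun _ _ _ => hκ⟩
    · obtain rfl : a = b := hab.resolve_right h
      exact ⟨𝟙 _, fun i hi hi' => absurd ⟨i, hi, hi'⟩ h⟩
  have := fun a b => hconn (vertexOb a) (vertexOb b)
  choose! κ hκ using hκ
  -- Dividing by `κ a a` makes `σ a a` trivial, so that the path to the end of an entry half-edge is
  -- exactly a tree path.
  let σ : ∀ a b : V, vertexOb a ⟶ vertexOb b := fun a b => Groupoid.inv (κ a a) ≫ κ a b
  have hσ1 : ∀ a, σ a a = 𝟙 _ := fun a => Groupoid.inv_comp _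
  have hσ : ∀ i a b, Joined S (c i) a → Joined S (c i) b →
      σ a b ∈ (edgeGroupoid S).arrows _ _ := fun i a b ha hb =>
    (edgeGroupoid S).mul ((edgeGroupoid S).inv (hκ a a (Or.inl rfl) i ha ha))
      (hκ a b (Or.inr ⟨i, ha, hb⟩) i ha hb)
  obtain ⟨δ, hδ0, hδs⟩ := exists_recursion (T := fun z => vertexOb (c o) ⟶ vertexOb z) depth
    (fun z _ => σ (c o) z) (fun z hz => (entry z hz).other) hlt
    (fun z hz q => q ≫ (entry z hz).arrow ≫ σ (entry z hz).1 z)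
  have hjoin : ∀ i a b, Joined S (c i) a → SameClass S c b a → Joined S (c i) b := by
    rintro i a b ha (rfl | ⟨j, h, h'⟩)
    · exact ha
    · obtain rfl := hc i j (ha.trans h'.symm)
      exact h
  refine ⟨δ, ?_, fun z hz => ?_, fun i a b ha hb => ?_⟩
  · rw [hδ0 _ ((h0 _).mpr (Or.inl rfl)), hσ1]
  · have hw : depth (entry z hz).1 ≠ 0 := by rwa [hdepth _ _ (hsame z hz)]
    have he := hentry _ _ hw hz (hsame z hz)
    rw [hδs _ hw]
    have key : ∀ (h h' : HalfEdge V) (e : h' = h), δ h'.other ≫ h'.arrow ≫ σ h'.1 h.1 =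
        δ h.other ≫ h.arrow := by
      rintro h _ rfl
      rw [hσ1, Category.comp_id]
    exact key _ _ he
  · have hab : SameClass S c a b := Or.inr ⟨i, ha, hb⟩
    have hdab := hdepth a b hab
    by_cases hz : depth a = 0
    · rw [hδ0 a hz, hδ0 b (hdab ▸ hz)]
      have hco := hjoin i a (c o) ha ((h0 a).mp hz)
      exact (edgeGroupoid S).mul ((edgeGroupoid S).inv (hσ i _ _ hco ha)) (hσ i _ _ hco hb)
    · have hz' : depth b ≠ 0 := hdab ▸ hz
      have he := hentry a b hz hz' hab
      have hw : Joined S (c i) (entry a hz).1 := hjoin i a _ ha (hsame a hz)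
      have h1 : δ b = δ (entry a hz).other ≫ (entry a hz).arrow ≫ σ (entry a hz).1 b := by
        rw [hδs b hz', he]
      rw [hδs a hz, h1]
      have h2 := (edgeGroupoid S).mul ((edgeGroupoid S).inv (hσ i _ _ hw ha)) (hσ i _ _ hw hb)
      simpa using h2

end AdaptedTrees

end FreeGroupDetection

end

noncomputable section

namespace FreeGroupDetection

/-! ### Fundamental groups of components of a subgraph as free factors -/

section ComponentFactors

open CategoryTheory Quiver

/-- The loops at `r` which are carried into a subgroupoid by a path. -/
def loopGroup {C : Type*} [Groupoid C] (T : Subgroupoid C) {r x : C} (δ : r ⟶ x)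
    (hx : 𝟙 x ∈ T.arrows x x) : Subgroup (r ⟶ r) where
  carrier := {g | Groupoid.inv δ ≫ g ≫ δ ∈ T.arrows x x}
  one_mem' := by
    change Groupoid.inv δ ≫ 𝟙 r ≫ δ ∈ T.arrows x x
    simpa using hx
  mul_mem' := by
    intro g h hg hh
    have := T.mul hg hh
    change Groupoid.inv δ ≫ (g ≫ h) ≫ δ ∈ T.arrows x x
    simpa using this
  inv_mem' := by
    intro g hg
    have := T.inv hg
    change Groupoid.inv δ ≫ Groupoid.inv g ≫ δ ∈ T.arrows x x
    simpa using this

theorem mem_loopGroup {C : Type*} [Groupoid C] {T : Subgroupoid C} {r x : C} {δ : r ⟶ x}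
    {hx : 𝟙 x ∈ T.arrows x x} {g : r ⟶ r} :
    g ∈ loopGroup T δ hx ↔ Groupoid.inv δ ≫ g ≫ δ ∈ T.arrows x x := Iff.rfl

variable {V : Type} [Quiver.{1} V]

theorem HalfEdge.joined {ι : Type} {S : ∀ a b : V, Set (a ⟶ b)} {c : ι → V} {i : ι}
    (h : HalfEdge V) (hS : h.edge.2.2 ∈ S _ _) (hi : Joined S (c i) h.edge.1) :
    Joined S (c i) h.1 ∧ Joined S (c i) h.other := by
  obtain ⟨z, ⟨b, e⟩ | ⟨b, e⟩⟩ := h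
  · exact ⟨hi, hi.trans (Joined.of_edge hS)⟩
  · exact ⟨hi.trans (Joined.of_edge hS), hi⟩

variable {ι : Type} {S : ∀ a b : V, Set (a ⟶ b)} {c : ι → V} {o : ι}
  {depth : V → ℕ} {entry : ∀ z, depth z ≠ 0 → HalfEdge V}

theorem not_joined_entry (hdepth : ∀ a b, SameClass S c a b → depth a = depth b)
    (hsame : ∀ z hz, SameClass S c (entry z hz).1 z)
    (hlt : ∀ z hz, depth (entry z hz).other < depth z) {i : ι} {z : V} {hz : depth z ≠ 0}
    (hS : (entry z hz).edge.2.2 ∈ S _ _) : ¬ Joined S (c i) (entry z hz).edge.1 := fun hi => by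
  have h1 := hdepth _ _ (Or.inr ⟨i, (entry z hz).joined hS hi⟩)
  have h2 := hdepth _ _ (hsame z hz)
  have h3 := hlt z hz
  omega

/-- In a graph without vertices of valence one, an adapted spanning tree for a single component of
a proper subgraph does not exhaust the remaining edges. -/
theorem exists_edge_not_tree [Finite V] (hι : ∀ i, i = o)
    (h0 : ∀ z, depth z = 0 ↔ SameClass S c (c o) z)
    (hentry : ∀ a b ha hb, SameClass S c a b → entry a ha = entry b hb)
    (hsame : ∀ z hz, SameClass S c (entry z hz).1 z)
    (hlt : ∀ z hz, depth (entry z hz).other < depth z)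
    (ho : Joined S (c o) (c o))
    (hval : ∀ a : V, Nat.card ((Σ b, (a ⟶ b)) ⊕ (Σ b, (b ⟶ a))) ≠ 1)
    (hS : ∃ (a b : V) (e : a ⟶ b), e ∉ S a b) :
    ∃ t : Σ a b : V, (a ⟶ b), (∀ i, t.2.2 ∈ S _ _ → ¬ Joined S (c i) t.1) ∧
      ∀ z hz, (entry z hz).edge ≠ t := by
  by_contra! hcon
  have : Nonempty V := ⟨c o⟩
  -- If the deepest vertex lies in the root class, there are no tree edges and the edge outside `S`
  -- is left over. Otherwise it forms a class by itself and has a half-edge besides its entry; were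
  -- that edge in the tree, it would lead to a deeper vertex.
  obtain ⟨z, hz⟩ := Finite.exists_max depth
  by_cases hz0 : depth z = 0
  · obtain ⟨a, b, e, he⟩ := hS
    obtain ⟨w, hw, -⟩ := hcon ⟨a, b, e⟩ fun i h => absurd h he
    exact hw (Nat.le_zero.mp ((hz w).trans hz0.le))
  have hzj : ∀ i, ¬ Joined S (c i) z := fun i hi => hz0 ((h0 z).mpr (Or.inr ⟨o, ho, hι i ▸ hi⟩))
  have hent : (entry z hz0).1 = z :=
    (hsame z hz0).resolve_right fun ⟨i, _, hi⟩ => hzj i hi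
  have hother : ∃ h : HalfEdge V, h.1 = z ∧ h ≠ entry z hz0 := by
    by_contra! hall
    refine hval z (Nat.card_eq_one_iff_unique.mpr ⟨⟨fun s t => ?_⟩, ?_⟩)
    · have := (hall ⟨z, s⟩ rfl).trans (hall ⟨z, t⟩ rfl).symm
      exact eq_of_heq (Sigma.mk.inj this).2
    · have : ∀ h : HalfEdge V, h.1 = z → Nonempty ((Σ b, (z ⟶ b)) ⊕ (Σ b, (b ⟶ z))) := by
        rintro ⟨_, s⟩ rfl
        exact ⟨s⟩
      exact this _ hent
  obtain ⟨h, hhz, hne⟩ := hother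
  obtain ⟨w, hw, hwe⟩ := hcon h.edge fun i hS hi => hzj i (hhz ▸ (h.joined hS hi).1)
  rcases HalfEdge.eq_or_other_eq hwe.symm with heq | heq
  · have h1 := hsame w hw
    rw [← heq, hhz] at h1
    exact hne (heq.trans (hentry z w hz0 hw h1).symm)
  · have h1 := hlt w hw
    rw [heq, hhz] at h1
    exact absurd (hz w) (not_le.mpr h1)

theorem HalfEdge.path_edge {r : Quiver.FreeGroupoid V} (δ : ∀ z : V, r ⟶ vertexOb z)
    (h : HalfEdge V) (hδ : δ h.1 = δ h.other ≫ h.arrow) :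
    δ h.edge.1 ≫ edgeArrow h.edge.2.2 ≫ Groupoid.inv (δ h.edge.2.1) = 𝟙 r := by
  obtain ⟨z, ⟨b, e⟩ | ⟨b, e⟩⟩ := h
  · change δ z = δ b ≫ Groupoid.inv (edgeArrow e) at hδ
    change δ z ≫ edgeArrow e ≫ Groupoid.inv (δ b) = _
    rw [hδ]
    simp
  · change δ z = δ b ≫ edgeArrow e at hδ
    change δ b ≫ edgeArrow e ≫ Groupoid.inv (δ z) = _
    rw [hδ]
    simp

/-- Collapsing the distinguished components turns the adapted tree into a spanning tree. Hence the
fundamental group is the free product of the component groups `P i`, transported along tree paths,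
and the free group `Q` on the edges outside the tree and these components. The inverse of `Θ` labels
edges by these three types, tree edges by `1`. -/
theorem exists_freeFactor_paths [Finite V] (hc : ∀ i j, Joined S (c i) (c j) → i = j) (o : ι)
    (hN : ∀ i, ∃ q ∈ (edgeGroupoid S).arrows (vertexOb (c i)) (vertexOb (c i)), q ≠ 𝟙 _)
    (hconn : ∀ a b : Quiver.FreeGroupoid V, Nonempty (a ⟶ b))
    (hval : ∀ a : V, Nat.card ((Σ b, (a ⟶ b)) ⊕ (Σ b, (b ⟶ a))) ≠ 1)
    (hS : ∃ (a b : V) (e : a ⟶ b), e ∉ S a b) :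
    ∃ (δ : ∀ i, vertexOb (c o) ⟶ vertexOb (c i))
      (P : ι → Subgroup (vertexOb (c o) ⟶ vertexOb (c o))) (Q : Type 1) (_ : Group Q)
      (Θ : Monoid.Coprod (Monoid.CoprodI fun i => P i) Q →* (vertexOb (c o) ⟶ vertexOb (c o))),
      Function.Bijective Θ ∧
      (∀ i (a : P i), Θ (.inl (Monoid.CoprodI.of (M := fun i => P i) a)) = a) ∧
      (∀ i g, g ∈ P i ↔ Groupoid.inv (δ i) ≫ g ≫ δ i ∈ (edgeGroupoid S).arrows _ _) ∧
      (∀ i, P i ≠ ⊥) ∧ ((∃ i j : ι, i ≠ j) ∨ Nontrivial Q) := by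
  classical
  obtain ⟨depth, entry, h0, hdepth, hentry, hsame, hlt⟩ := exists_depth_entry hc (c o) hconn
  obtain ⟨δ, hδo, hδe, hδj⟩ :=
    exists_tree_paths hc o hconn depth entry h0 hdepth hentry hsame hlt
  have hjr : ∀ i, Joined S (c i) (c i) := fun i => by
    obtain ⟨q, hq, -⟩ := hN i
    exact ⟨q, hq⟩
  have hid : ∀ i, 𝟙 (vertexOb (c i)) ∈ (edgeGroupoid S).arrows _ _ := fun i => by
    obtain ⟨q, hq, -⟩ := hN i
    exact Subgroupoid.id_mem_of_src _ hq
  let P : ι → Subgroup (vertexOb (c o) ⟶ vertexOb (c o)) := fun i =>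
    loopGroup (edgeGroupoid S) (δ (c i)) (hid i)
  have hP : ∀ i a b (q : vertexOb a ⟶ vertexOb b), Joined S (c i) a → Joined S (c i) b →
      q ∈ (edgeGroupoid S).arrows _ _ → δ a ≫ q ≫ Groupoid.inv (δ b) ∈ P i := by
    intro i a b q ha hb hq
    have := (edgeGroupoid S).mul (hδj i _ _ (hjr i) ha)
      ((edgeGroupoid S).mul hq (hδj i _ _ hb (hjr i)))
    rw [mem_loopGroup]
    simpa using this
  let IsFree : (Σ a b : V, (a ⟶ b)) → Prop := fun t =>
    (∀ i, t.2.2 ∈ S _ _ → ¬ Joined S (c i) t.1) ∧ ∀ z hz, (entry z hz).edge ≠ t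
  let Q : Type 1 := FreeGroup {t // IsFree t}
  let H : Type 1 := Monoid.Coprod (Monoid.CoprodI fun i => P i) Q
  let inP : ∀ i, P i →* H := fun i =>
    Monoid.Coprod.inl.comp (Monoid.CoprodI.of (M := fun i => P i) (i := i))
  let x : (Σ a b : V, (a ⟶ b)) → (vertexOb (c o) ⟶ vertexOb (c o)) := fun t =>
    δ t.1 ≫ edgeArrow t.2.2 ≫ Groupoid.inv (δ t.2.1)
  let Θ : H →* (vertexOb (c o) ⟶ vertexOb (c o)) :=
    Monoid.Coprod.lift (Monoid.CoprodI.lift fun i => (P i).subtype)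
      (FreeGroup.lift fun t => x t.1)
  have hΘP : ∀ i (a : P i), Θ (inP i a) = a := fun i a =>
    (Monoid.Coprod.lift_apply_inl _ _ _).trans (Monoid.CoprodI.lift_of _ _)
  have hΘQ : ∀ t, Θ (.inr (FreeGroup.of t)) = x t.1 := fun t =>
    (Monoid.Coprod.lift_apply_inr _ _ _).trans (FreeGroup.lift_apply_of)
  have hl : ∀ t : Σ a b : V, (a ⟶ b), ∃ l : H, Θ l = x t ∧
      (∀ i, t.2.2 ∈ S _ _ → Joined S (c i) t.1 → l ∈ (inP i).range) ∧
      (∀ z hz, (entry z hz).edge = t → l = 1) ∧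
      ∀ h : IsFree t, l = .inr (FreeGroup.of ⟨t, h⟩) := by
    intro t
    by_cases h1 : ∃ i, t.2.2 ∈ S _ _ ∧ Joined S (c i) t.1
    · obtain ⟨i, h1, h2⟩ := h1
      refine ⟨inP i ⟨x t, hP i _ _ _ h2 (h2.trans (Joined.of_edge h1)) (edgeArrow_mem h1)⟩,
        hΘP _ _, fun j _ h3 => ?_, ?_, fun h => absurd h2 (h.1 i h1)⟩
      · obtain rfl := hc _ _ (h3.trans h2.symm)
        exact ⟨_, rfl⟩
      · rintro z hz rfl
        exact absurd h2 (not_joined_entry hdepth hsame hlt h1)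
    · push Not at h1
      by_cases h2 : ∃ z hz, (entry z hz).edge = t
      · refine ⟨1, ?_, fun i h3 h4 => absurd h4 (h1 i h3), fun _ _ _ => rfl, fun h => ?_⟩
        · obtain ⟨z, hz, rfl⟩ := h2
          rw [map_one]
          exact (HalfEdge.path_edge δ _ (hδe z hz)).symm
        · obtain ⟨z, hz, h3⟩ := h2
          exact absurd h3 (h.2 z hz)
      · push Not at h2
        exact ⟨.inr (FreeGroup.of ⟨t, h1, h2⟩), hΘQ _, fun i h3 h4 => absurd h4 (h1 i h3),
          fun z hz h => absurd h (h2 z hz), fun _ => rfl⟩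
  choose l hlΘ hlP hl1 hlQ using hl
  obtain ⟨Λ, hΛid, hΛcomp, hΛinv, hΛedge⟩ := exists_labelling (V := V) (H := H)
    (fun {a b} e => l ⟨a, b, e⟩)
  have hΘΛ : ∀ {x y : Quiver.FreeGroupoid V} (q : x ⟶ y),
      Θ (Λ q) = δ x.as ≫ q ≫ Groupoid.inv (δ y.as) := fun q =>
    eq_of_labelling (fun {a b} e => l ⟨a, b, e⟩) Λ hΛid hΛcomp hΛinv hΛedge (fun x => δ x.as) Θ
      (fun {a b} e => hlΘ ⟨a, b, e⟩) q
  have hΛP : ∀ i a b (q : vertexOb a ⟶ vertexOb b), Joined S (c i) a →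
      q ∈ (edgeGroupoid S).arrows _ _ → ∀ g : P i, (g : vertexOb (c o) ⟶ vertexOb (c o)) =
        δ a ≫ q ≫ Groupoid.inv (δ b) → Λ q = inP i g := by
    intro i a b q ha hq g hg
    -- Induction over edge paths only places the label in the image of `P i`; applying `Θ` then
    -- identifies the element.
    let T : Subgroupoid (Quiver.FreeGroupoid V) :=
      { arrows := fun x y => {q | (Joined S (c i) x.as ↔ Joined S (c i) y.as) ∧
          (Joined S (c i) x.as → Λ q ∈ (inP i).range)}
        inv := by
          rintro x y q ⟨h1, h2⟩
          refine ⟨h1.symm, fun h => ?_⟩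
          rw [hΛinv]
          exact inv_mem (h2 (h1.mpr h))
        mul := by
          rintro x y z q ⟨h1, h2⟩ r ⟨h3, h4⟩
          refine ⟨h1.trans h3, fun h => ?_⟩
          rw [hΛcomp]
          exact mul_mem (h2 h) (h4 (h1.mp h)) }
    have hT : q ∈ T.arrows _ _ := by
      refine edgeGroupoid_induction (S := S) T (fun a b e he => ⟨⟨fun h => h.trans (Joined.of_edge he),
        fun h => h.trans (Joined.of_edge he).symm⟩, fun h => ?_⟩) hq
      rw [hΛedge]
      exact hlP ⟨a, b, e⟩ i he h
    obtain ⟨g', hg'⟩ := hT.2 ha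
    have h1 := hΘΛ q
    rw [← hg', hΘP] at h1
    rw [← hg', Subtype.ext (h1.trans hg.symm)]
  have hΛsame : ∀ a b, SameClass S c a b → Λ (δ a) = Λ (δ b) := by
    rintro a b (rfl | ⟨i, ha, hb⟩)
    · rfl
    · have := hΛP i a b _ ha (hδj i a b ha hb) 1 (by
        change 𝟙 _ = _
        simp)
      rw [map_one, hΛcomp, hΛinv] at this
      exact inv_mul_eq_one.mp this
  have hΛarrow : ∀ h : HalfEdge V, l h.edge = 1 → Λ h.arrow = 1 := by
    rintro ⟨z, ⟨b, e⟩ | ⟨b, e⟩⟩ h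
    · change Λ (Groupoid.inv (edgeArrow e)) = 1
      rw [hΛinv, hΛedge]
      exact inv_eq_one.mpr h
    · change Λ (edgeArrow e) = 1
      rw [hΛedge]
      exact h
  have hΛδ : ∀ m z, depth z = m → Λ (δ z) = 1 := by
    intro m
    induction m using Nat.strong_induction_on with
    | _ m ih =>
      intro z hm
      by_cases hz : depth z = 0
      · rw [← hΛsame _ _ ((h0 z).mp hz), hδo, hΛid]
      · rw [← hΛsame _ _ (hsame z hz), hδe, hΛcomp, ih _ (hm ▸ hlt z hz) _ rfl,
          hΛarrow _ (hl1 _ z hz rfl), one_mul]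
  have hΛδ' : ∀ z, Λ (δ z) = 1 := fun z => hΛδ _ z rfl
  refine ⟨fun i => δ (c i), P, Q, inferInstance, Θ, ⟨?_, ?_⟩, hΘP, fun i g => Iff.rfl,
    fun i hi => ?_, ?_⟩
  · let Λ' : (vertexOb (c o) ⟶ vertexOb (c o)) →* H := MonoidHom.mk' (fun q => Λ q) hΛcomp
    have h : Λ'.comp Θ = MonoidHom.id _ := by
      refine Monoid.Coprod.hom_ext (Monoid.CoprodI.ext_hom _ _ fun i => ?_) ?_
      · ext g
        change Λ (Θ (inP i g)) = inP i g
        rw [hΘP, ← hΛP i _ _ _ (hjr i) (mem_loopGroup.mp g.2) g (by simp)]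
        rw [hΛcomp, hΛcomp, hΛinv, hΛδ']
        simp
      · ext t
        change Λ (Θ (.inr (FreeGroup.of t))) = .inr (FreeGroup.of t)
        rw [hΘQ, hΛcomp, hΛcomp, hΛinv, hΛδ', hΛδ', hΛedge, hlQ _ t.2]
        simp
    exact Function.LeftInverse.injective (g := Λ') fun w => DFunLike.congr_fun h w
  · intro q
    refine ⟨Λ q, (hΘΛ q).trans ?_⟩
    change δ (c o) ≫ q ≫ Groupoid.inv (δ (c o)) = q
    rw [hδo]
    simp
  · obtain ⟨q, hq, hne⟩ := hN i
    have h1 := hP i _ _ q (hjr i) (hjr i) hq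
    rw [hi, Subgroup.mem_bot] at h1
    have h2 : δ (c i) ≫ q ≫ Groupoid.inv (δ (c i)) = 𝟙 _ := h1
    refine hne ?_
    have h3 : q = Groupoid.inv (δ (c i)) ≫ (δ (c i) ≫ q ≫ Groupoid.inv (δ (c i))) ≫ δ (c i) := by
      simp
    rw [h3, h2]
    simp
  · by_cases hι : ∃ i j : ι, i ≠ j
    · exact Or.inl hι
    · push Not at hι
      obtain ⟨t, ht⟩ := exists_edge_not_tree (fun i => hι i o) h0 hentry hsame hlt (hjr o)
        hval hS
      exact Or.inr ⟨FreeGroup.of ⟨t, ht⟩, 1, FreeGroup.of_ne_one _⟩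

end ComponentFactors

end FreeGroupDetection

end

noncomputable section

namespace FreeGroupDetection

/-! ### Reducible automorphisms permute free factor systems -/

section FreeFactorSystems

open Monoid

/-- Abstract factors are replaced by their images in `F`. Such an image is proper because some other
factor is nontrivial, and a projection of the free product detects that factor while killing the
given one. -/
theorem isFreeFactorSystem_of_bijective {F : Type} [Group F] {k : ℕ} {P : Fin (k + 1) → Type*}
    [∀ i, Group (P i)] {Q : Type*} [Group Q] (Θ : Coprod (CoprodI P) Q →* F)
    (hΘ : Function.Bijective Θ) (hP : ∀ i, Nontrivial (P i))
    (hQ : (∃ i j : Fin (k + 1), i ≠ j) ∨ Nontrivial Q) :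
    IsFreeFactorSystem fun i =>
      (Θ.comp (Coprod.inl.comp (CoprodI.of (M := P) (i := i)))).range := by
  classical
  let θ : ∀ i, P i →* F := fun i => Θ.comp (Coprod.inl.comp (CoprodI.of (M := P) (i := i)))
  let A : Fin (k + 1) → Subgroup F := fun i => (θ i).range
  let B : Subgroup F := (Θ.comp Coprod.inr).range
  have hθ : ∀ i, Function.Injective (θ i) := fun i =>
    hΘ.1.comp (Coprod.inl_injective.comp (CoprodI.of_injective i))
  refine ⟨fun i => ⟨fun hi => ?_, fun hi => ?_⟩, B, ?_⟩
  · obtain ⟨b, hb⟩ := exists_ne (1 : P i)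
    have h1 : θ i b ∈ A i := ⟨b, rfl⟩
    rw [show A i = ⊥ from hi, Subgroup.mem_bot] at h1
    exact hb (hθ i (h1.trans (map_one _).symm))
  · have htop : ∀ x, x ∈ A i := fun x => by
      rw [show A i = ⊤ from hi]
      trivial
    have hQi : Nontrivial Q → False := fun _ => by
      obtain ⟨b, hb⟩ := exists_ne (1 : Q)
      obtain ⟨a, ha⟩ := htop (Θ (.inr b))
      have h1 := congrArg Coprod.snd (hΘ.1 ha)
      rw [Coprod.snd_apply_inr] at h1
      exact hb (h1.symm.trans (Coprod.snd_apply_inl _))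
    have hij : (∃ j, j ≠ i) → False := by
      rintro ⟨j, hj⟩
      obtain ⟨b, hb⟩ := exists_ne (1 : P j)
      obtain ⟨a, ha⟩ := htop (θ j b)
      have h1 : CoprodI.of (M := P) a = CoprodI.of b := Coprod.inl_injective (hΘ.1 ha)
      have h2 := congrArg (CoprodI.lift fun l => MonoidHom.mulSingle P l) h1
      rw [CoprodI.lift_of, CoprodI.lift_of] at h2
      have h3 := congrFun h2 j
      simp only [MonoidHom.mulSingle_apply, Pi.mulSingle_eq_same, Pi.mulSingle_eq_of_ne hj] at h3
      exact hb h3.symm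
    rcases hQ with ⟨a, b, hab⟩ | hQ
    · by_cases h : a = i
      · exact hij ⟨b, fun h' => hab (h.trans h'.symm)⟩
      · exact hij ⟨a, h⟩
    · exact hQi hQ
  · let M : Coprod (CoprodI fun i => A i) B →* F :=
      Coprod.lift (CoprodI.lift fun i => (A i).subtype) B.subtype
    let L : Coprod (CoprodI P) Q →* Coprod (CoprodI fun i => A i) B :=
      Coprod.lift (CoprodI.lift fun i =>
        Coprod.inl.comp ((CoprodI.of (M := fun i => A i) (i := i)).comp (θ i).rangeRestrict))
        (Coprod.inr.comp (Θ.comp Coprod.inr).rangeRestrict)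
    let eΘ := MulEquiv.ofBijective Θ hΘ
    let R : F →* Coprod (CoprodI fun i => A i) B := L.comp eΘ.symm.toMonoidHom
    have hR : ∀ x, R (Θ x) = L x := fun x => congrArg L (eΘ.symm_apply_apply x)
    have hML : M.comp L = Θ := by
      refine Coprod.hom_ext (CoprodI.ext_hom _ _ fun i => ?_) ?_
      · ext b
        simp only [M, L, MonoidHom.comp_apply, Coprod.lift_apply_inl, CoprodI.lift_of]
        rfl
      · ext b
        simp only [M, L, MonoidHom.comp_apply, Coprod.lift_apply_inr]
        rfl
    have hRM : R.comp M = MonoidHom.id _ := by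
      refine Coprod.hom_ext (CoprodI.ext_hom _ _ fun i => ?_) ?_
      · ext ⟨_, b, rfl⟩
        have h1 : M (.inl (CoprodI.of (M := fun i => A i) (i := i) ⟨_, b, rfl⟩)) =
          Θ (.inl (CoprodI.of b)) := by
          simp [M, θ]
        change R (M _) = _
        rw [h1, hR]
        simp only [L, Coprod.lift_apply_inl, CoprodI.lift_of]
        rfl
      · ext ⟨_, b, rfl⟩
        have h1 : M (.inr ⟨_, b, rfl⟩) = Θ (.inr b) := by
          simp [M]
        change R (M _) = _
        rw [h1, hR]
        simp only [L, Coprod.lift_apply_inr]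
        rfl
    refine ⟨Function.LeftInverse.injective (g := R) fun w => DFunLike.congr_fun hRM w,
      fun y => ?_⟩
    obtain ⟨x, rfl⟩ := hΘ.2 y
    exact ⟨L x, DFunLike.congr_fun hML x⟩

end FreeFactorSystems

/-! ### Cycles of components of an invariant subgraph -/

section

open CategoryTheory Quiver

/-- A self-map of a finite set which respects a symmetric and transitive relation permutes
cyclically, up to the relation, some pairwise unrelated points of any forward orbit. -/
theorem exists_cycle {X : Type*} [Finite X] {J : X → X → Prop} (hsymm : ∀ {a b}, J a b → J b a)
    (htrans : ∀ {a b d}, J a b → J b d → J a d) {φ : X → X} (hφ : ∀ {a b}, J a b → J (φ a) (φ b))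
    {x : X} (hx : J x x) :
    ∃ (k : ℕ) (c : Fin (k + 1) → X), (∀ i, ∃ s, c i = φ^[s] x) ∧
      (∀ i j, J (c i) (c j) → i = j) ∧ ∀ i, J (φ (c i)) (c (i + 1)) := by
  classical
  have hφn : ∀ m {a b}, J a b → J (φ^[m] a) (φ^[m] b) := fun m => by
    induction m with
    | zero => exact fun h => h
    | succ m ih =>
      intro a b h
      rw [Function.iterate_succ_apply', Function.iterate_succ_apply']
      exact hφ (ih h)
  obtain ⟨s, t, hst, he⟩ : ∃ s t, s < t ∧ φ^[s] x = φ^[t] x := by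
    obtain ⟨s, t, hne, he⟩ := Finite.exists_ne_map_eq_of_infinite fun m : ℕ => φ^[m] x
    rcases Nat.lt_or_gt_of_ne hne with h | h
    exacts [⟨s, t, h, he⟩, ⟨t, s, h, he.symm⟩]
  obtain ⟨y, ⟨s, hys⟩, hy, hex⟩ :
      ∃ y, (∃ s, φ^[s] x = y) ∧ J y y ∧ ∃ d, 0 < d ∧ J y (φ^[d] y) := by
    refine ⟨φ^[s] x, ⟨s, rfl⟩, hφn s hx, t - s, by omega, ?_⟩
    have h1 : φ^[t - s] (φ^[s] x) = φ^[s] x := by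
      rw [← Function.iterate_add_apply, he]
      congr 1
      omega
    rw [h1]
    exact hφn s hx
  obtain ⟨hd, hdy⟩ := Nat.find_spec hex
  have hmin : ∀ m, 0 < m → m < Nat.find hex → ¬ J y (φ^[m] y) := fun m h1 h2 h3 =>
    Nat.find_min hex h2 ⟨h1, h3⟩
  obtain ⟨k, hk⟩ := Nat.exists_eq_succ_of_ne_zero hd.ne'
  rw [hk] at hdy hmin
  have hlt : ∀ i j : Fin (k + 1), i < j → ¬ J (φ^[i] y) (φ^[j] y) := fun i j hij h => by
    have hi := i.2
    have hj := j.2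
    have hij' : (i : ℕ) < j := hij
    refine hmin (j - i) (by omega) (by omega) ?_
    -- Pushed forward past time `k + 1`, where the orbit is again related to `y`, the relation
    -- becomes a return after `j - i` steps, contradicting the minimality of `k + 1`.
    have h1 := hφn (k + 1 - i) h
    rw [← Function.iterate_add_apply, ← Function.iterate_add_apply,
      show k + 1 - (i : ℕ) + i = k + 1 by omega,
      show k + 1 - (i : ℕ) + j = (j - i) + (k + 1) by omega,
      Function.iterate_add_apply φ (j - i) (k + 1)] at h1
    exact htrans (htrans hdy h1) (hsymm (hφn (j - i) hdy))
  refine ⟨k, fun i => φ^[i] y, fun i => ⟨i + s, by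
      rw [Function.iterate_add_apply, hys]⟩,
    fun i j h => ?_, fun i => ?_⟩
  · rcases lt_trichotomy i j with h1 | h1 | h1
    · exact absurd h (hlt i j h1)
    · exact h1
    · exact absurd (hsymm h) (hlt j i h1)
  · change J (φ (φ^[i] y)) (φ^[((i + 1 : Fin (k + 1)) : ℕ)] y)
    rw [← Function.iterate_succ_apply' φ i y]
    by_cases h : i = Fin.last k
    · subst h
      rw [Fin.last_add_one]
      exact hsymm hdy
    · rw [Fin.val_add_one_of_lt (Fin.lt_last_iff_ne_last.mpr h)]
      exact hφn _ hy

/-- Injectivity of `ψ` makes `f` injective on vertex groups, so components with nontrivial loops go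
to such components. As there are finitely many vertices, some of these components are permuted
cyclically, and their fundamental groups form the free factor system. -/
theorem exists_isFreeFactorSystem_of_isReducible {n : ℕ} {ψ : MulAut (FreeGroup (Fin n))}
    (h : IsReducible ψ) : ∃ (k : ℕ) (A : Fin (k + 1) → Subgroup (FreeGroup (Fin n))),
      IsFreeFactorSystem A ∧ ∀ i, ∀ a ∈ A i, ∃ a' ∈ A (i + 1), IsConj (ψ a) a' := by
  obtain ⟨V, _, _, -, v, m, f, γ, S, hconn, hval, hm, hS, ⟨x, q, hq, hq1⟩, hf⟩ := h
  let φ : V → V := fun a => (f.obj (vertexOb a)).as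
  have hfS : ∀ {x y : Quiver.FreeGroupoid V} {q : x ⟶ y}, q ∈ (edgeGroupoid S).arrows x y →
      f.map q ∈ (edgeGroupoid S).arrows _ _ := fun hq =>
    edgeGroupoid_induction (S := S) ((edgeGroupoid S).comap f) hf hq
  have hmul : ∀ u w, m (u * w) = m u ≫ m w := fun u w => map_mul m u w
  have hminv : ∀ u, m u⁻¹ = Groupoid.inv (m u) := fun u => map_inv m u
  have hf1 : ∀ {x : Quiver.FreeGroupoid V} {q : x ⟶ x}, f.map q = 𝟙 _ → q = 𝟙 x := by
    intro x q hq
    obtain ⟨β⟩ := hconn v x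
    obtain ⟨w, hw⟩ := m.surjective (β ≫ q ≫ Groupoid.inv β)
    have h1 : m (ψ w) = m 1 := by
      rw [hm, hw, map_one, Functor.map_comp, Functor.map_comp, hq, map_groupoid_inv]
      change _ = 𝟙 v
      simp
    have h2 : w = 1 := ψ.injective ((m.injective h1).trans (map_one _).symm)
    rw [h2, map_one] at hw
    have h3 : q = Groupoid.inv β ≫ (β ≫ q ≫ Groupoid.inv β) ≫ β := by simp
    rw [h3, ← hw]
    change Groupoid.inv β ≫ 𝟙 v ≫ β = 𝟙 x
    simp
  let N : V → Prop := fun a => ∃ q ∈ (edgeGroupoid S).arrows (vertexOb a) (vertexOb a), q ≠ 𝟙 _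
  obtain ⟨x₀, hx₀⟩ : ∃ x₀, N x₀ := ⟨x.as, q, hq, hq1⟩
  have hN : ∀ s, N (φ^[s] x₀) := fun s => by
    induction s with
    | zero => exact hx₀
    | succ s ih =>
      obtain ⟨q, hq, hq1⟩ := ih
      rw [Function.iterate_succ_apply']
      exact ⟨f.map q, hfS hq, fun h => hq1 (hf1 h)⟩
  obtain ⟨k, c, hcx, hc, hcφ⟩ := exists_cycle (J := Joined S) (φ := φ) (x := x₀)
    Joined.symm Joined.trans (fun {a b} ⟨q, hq⟩ => ⟨f.map q, hfS hq⟩) (hx₀.imp fun _ h => h.1)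
  have hcN : ∀ i, N (c i) := fun i => by
    obtain ⟨s, hs⟩ := hcx i
    rw [hs]
    exact hN s
  obtain ⟨δ, P, Q, _, Θ, hΘ, hΘP, hPδ, hPne, hQ⟩ :=
    exists_freeFactor_paths hc 0 hcN hconn hval hS
  obtain ⟨β⟩ := hconn v (vertexOb (c 0))
  let J : (vertexOb (c 0) ⟶ vertexOb (c 0)) →* FreeGroup (Fin n) :=
    MonoidHom.mk' (fun q => m.symm (β ≫ q ≫ Groupoid.inv β)) fun q r => by
      apply m.injective
      rw [hmul, m.apply_symm_apply, m.apply_symm_apply, m.apply_symm_apply]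
      change β ≫ (q ≫ r) ≫ Groupoid.inv β = _
      simp
  have hmJ : ∀ q, m (J q) = β ≫ q ≫ Groupoid.inv β := fun q => m.apply_symm_apply _
  have hJ : Function.Bijective J := by
    constructor
    · intro q r h
      have h1 := congrArg m h
      rw [hmJ, hmJ] at h1
      have h2 : ∀ q, q = Groupoid.inv β ≫ (β ≫ q ≫ Groupoid.inv β) ≫ β := by simp
      rw [h2 q, h1, ← h2]
    · intro w
      refine ⟨Groupoid.inv β ≫ m w ≫ β, m.injective ?_⟩
      rw [hmJ]
      simp
  refine ⟨k, _, isFreeFactorSystem_of_bijective (J.comp Θ) (hJ.comp hΘ)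
    (fun i => (Subgroup.nontrivial_iff_ne_bot _).mpr (hPne i)) hQ, ?_⟩
  rintro i _ ⟨p, rfl⟩
  obtain ⟨τ, hτ⟩ : ∃ τ : f.obj (vertexOb (c i)) ⟶ vertexOb (c (i + 1)),
    τ ∈ (edgeGroupoid S).arrows _ _ := hcφ i
  have hp := hfS ((hPδ i p).mp p.2)
  let u := Groupoid.inv τ ≫ f.map (Groupoid.inv (δ i) ≫
    (p : vertexOb (c 0) ⟶ vertexOb (c 0)) ≫ δ i) ≫ τ
  have hu : u ∈ (edgeGroupoid S).arrows _ _ :=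
    (edgeGroupoid S).mul ((edgeGroupoid S).inv hτ) ((edgeGroupoid S).mul hp hτ)
  have hp' : δ (i + 1) ≫ u ≫ Groupoid.inv (δ (i + 1)) ∈ P (i + 1) := by
    rw [hPδ]
    simpa using hu
  refine ⟨_, ⟨⟨_, hp'⟩, rfl⟩, ?_⟩
  have h1 : ∀ i p, J.comp Θ (.inl (Monoid.CoprodI.of (M := fun i => P i) (i := i) p)) = J p :=
    fun i p => congrArg J (hΘP i p)
  change IsConj (ψ (J.comp Θ (.inl (Monoid.CoprodI.of (M := fun i => P i) (i := i) p))))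
    (J.comp Θ (.inl (Monoid.CoprodI.of (M := fun i => P i) (i := i + 1) ⟨_, hp'⟩)))
  rw [h1, h1, isConj_iff]
  -- This loop runs out to the next component and returns along the image under `f` of the path to
  -- the current one.
  refine ⟨m.symm (β ≫ δ (i + 1) ≫ Groupoid.inv τ ≫ Groupoid.inv (f.map (δ i)) ≫
    Groupoid.inv (f.map β) ≫ Groupoid.inv γ), m.injective ?_⟩
  rw [hmul, hmul, hminv, m.apply_symm_apply, hm, hmJ, hmJ]
  simp [u]

end

end FreeGroupDetection

end

namespace FreeGroupDetection

/-! ### Detection of finite order and irreducible automorphisms -/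

section Detection

/-- An automorphism of an infinite cyclic group is inversion or the identity. -/
theorem sq_eq_one_of_subsingleton {α : Type} [Subsingleton α] (ψ : MulAut (FreeGroup α)) :
    ψ ^ 2 = 1 := by
  have hpow : ∀ (i : α) (w : FreeGroup α), ∃ a : ℤ, FreeGroup.of i ^ a = w := fun i w => by
    have h : w ∈ Subgroup.closure (Set.range (FreeGroup.of (α := α))) := by
      rw [FreeGroup.closure_range_of]
      trivial
    have hr : Set.range (FreeGroup.of (α := α)) = {FreeGroup.of i} :=
      Set.eq_singleton_iff_unique_mem.mpr ⟨⟨i, rfl⟩, by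
        rintro _ ⟨j, rfl⟩
        rw [Subsingleton.elim j i]⟩
    rw [hr] at h
    exact Subgroup.mem_closure_singleton.mp h
  have hinj : ∀ (i : α) (a b : ℤ), FreeGroup.of i ^ a = FreeGroup.of i ^ b → a = b :=
    fun i a b h => by
      have := congrArg (FreeGroup.lift fun _ : α => Multiplicative.ofAdd (1 : ℤ)) h
      rw [map_zpow, map_zpow, FreeGroup.lift_apply_of, ← ofAdd_zsmul, ← ofAdd_zsmul] at this
      simpa using this
  refine MulEquiv.toMonoidHom_injective (FreeGroup.ext_hom _ _ fun i => ?_)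
  change (ψ ^ 2) (FreeGroup.of i) = FreeGroup.of i
  obtain ⟨a, ha⟩ := hpow i (ψ (FreeGroup.of i))
  obtain ⟨b, hb⟩ := hpow i (ψ.symm (FreeGroup.of i))
  have h1 : FreeGroup.of i ^ (a * b) = FreeGroup.of i ^ (1 : ℤ) := by
    rw [zpow_mul, ha, ← map_zpow, hb, ψ.apply_symm_apply, zpow_one]
  have h2 : a * a = 1 := by
    rcases Int.eq_one_or_neg_one_of_mul_eq_one (hinj i _ _ h1) with rfl | rfl <;> rfl
  rw [pow_two, MulAut.mul_apply, ← ha, map_zpow, ← ha, ← zpow_mul, h2, zpow_one]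

/-- The action of `φ` intertwines those of `g` and `φ g`. If it is trivial, `φ g * g⁻¹` has the same
deck character values as `1`, and only `1` is conjugate to `1`. -/
theorem eq_one_of_autRep_eq_one {α : Type} [Finite α] {p : ℕ} (hα : 2 ≤ Nat.card α) (hp : p.Prime)
    (K : PCoverSystem (FreeGroup α) p) {φ : MulAut (FreeGroup α)} (hφ : autRep K φ = 1) :
    φ = 1 := by
  have hdeck : ∀ g, deckRep K (φ g) = deckRep K g := fun g => by
    have h1 : MulAut.conj (φ g) = φ * MulAut.conj g * φ⁻¹ := by
      ext x
      simp [MulAut.conj_apply]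
    change autRep K (MulAut.conj (φ g)) = autRep K (MulAut.conj g)
    have h2 : autRep K φ⁻¹ = 1 := by
      have h3 := map_mul (autRep K) φ φ⁻¹
      rwa [mul_inv_cancel, map_one, hφ, one_mul, eq_comm] at h3
    rw [h1, map_mul, map_mul, hφ, h2, one_mul, mul_one]
  ext g
  have h1 : IsConj 1 (φ g * g⁻¹) := by
    rw [isConj_iff_deckCharacter hα hp K]
    rintro _ ⟨V, _, _, _, ρ, ι, -, -, hι, hιρ, rfl⟩
    have h2 : ρ (φ g) = ρ g := by
      ext v
      apply hι
      rw [hιρ, hιρ, hdeck]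
    have h3 : ρ (φ g * g⁻¹) = ρ 1 := by
      rw [map_mul, h2, ← map_mul, mul_inv_cancel]
    rw [Representation.character, Representation.character, h3]
  exact mul_inv_eq_one.mp (isConj_one_right.mp h1)

theorem mk_eq_one_iff_isConj {α : Type} [Nontrivial α] (φ : MulAut (FreeGroup α)) :
    (QuotientGroup.mk φ : Out (FreeGroup α)) = 1 ↔ ∀ g, IsConj (φ g) g := by
  classical
  rw [QuotientGroup.eq_one_iff]
  constructor
  · rintro ⟨c, rfl⟩ g
    exact (isConj_iff.mpr ⟨c, rfl⟩).symm
  · intro h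
    obtain ⟨x, y, hxy⟩ := exists_pair_ne α
    obtain ⟨c, hc⟩ := exists_conj_of_pointwise_inner hxy fun g => (h g).symm
    exact ⟨c, hc.symm⟩

theorem isReducible_iff {n : ℕ} {ψ : MulAut (FreeGroup (Fin n))} :
    IsReducible ψ ↔ ∃ (k : ℕ) (A : Fin (k + 1) → Subgroup (FreeGroup (Fin n))),
      IsFreeFactorSystem A ∧ ∀ i, ∀ a ∈ A i, ∃ a' ∈ A (i + 1), IsConj (ψ a) a' :=
  ⟨exists_isFreeFactorSystem_of_isReducible,
    fun ⟨_, _, hA, h⟩ => isReducible_of_isFreeFactorSystem hA h⟩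

end Detection

end FreeGroupDetection

theorem theorem6p1 (n p : ℕ) (hp : p.Prime)
    (K : FreeGroupDetection.PCoverSystem (FreeGroup (Fin n)) p)
    (ψ : MulAut (FreeGroup (Fin n))) :
    -- finite order in `Aut(F_n)`
    (IsOfFinOrder ψ ↔ IsOfFinOrder (FreeGroupDetection.autRep K ψ)) ∧
    -- finite order in `Out(F_n)`
    (IsOfFinOrder (QuotientGroup.mk ψ : FreeGroupDetection.Out (FreeGroup (Fin n))) ↔
      ∃ m : ℕ, 0 < m ∧ ∀ χ, FreeGroupDetection.IsDeckCharacter K χ →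
        ∀ g, χ ((ψ ^ m) g) = χ g) ∧
    (2 ≤ n → ∀ m : ℕ, (QuotientGroup.mk ψ : FreeGroupDetection.Out (FreeGroup (Fin n))) ^ m = 1 ↔
      ∀ χ, FreeGroupDetection.IsDeckCharacter K χ → ∀ g, χ ((ψ ^ m) g) = χ g) ∧
    -- irreducibility
    (FreeGroupDetection.IsIrreducible ψ ↔
      ∀ (k : ℕ) (A : Fin (k + 1) → Subgroup (FreeGroup (Fin n))),
        FreeGroupDetection.IsFreeFactorSystem A →
        ∃ i, ∃ a ∈ A i, ∀ a' ∈ A (i + 1),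
          ∃ χ, FreeGroupDetection.IsDeckCharacter K χ ∧ χ (ψ a) ≠ χ a') := by
  by_cases hn : 2 ≤ n
  · have hα : 2 ≤ Nat.card (Fin n) := by rwa [Nat.card_fin]
    have : Nontrivial (Fin n) := Fin.nontrivial_iff_two_le.mpr hn
    have hout : ∀ m : ℕ, (QuotientGroup.mk ψ : FreeGroupDetection.Out (FreeGroup (Fin n))) ^ m = 1 ↔
        ∀ χ, FreeGroupDetection.IsDeckCharacter K χ → ∀ g, χ ((ψ ^ m) g) = χ g := fun m => by
      rw [← QuotientGroup.mk_pow, FreeGroupDetection.mk_eq_one_iff_isConj]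
      simp only [FreeGroupDetection.isConj_iff_deckCharacter hα hp K]
      exact ⟨fun h χ hχ g => h g χ hχ, fun h g χ hχ => h χ hχ g⟩
    refine ⟨⟨fun h => (FreeGroupDetection.autRep K).isOfFinOrder h, fun h => ?_⟩, ?_,
      fun _ => hout, ?_⟩
    · obtain ⟨m, hm, h1⟩ := isOfFinOrder_iff_pow_eq_one.mp h
      rw [← map_pow] at h1
      exact isOfFinOrder_iff_pow_eq_one.mpr
        ⟨m, hm, FreeGroupDetection.eq_one_of_autRep_eq_one hα hp K h1⟩
    · simp only [isOfFinOrder_iff_pow_eq_one, hout]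
    · rw [FreeGroupDetection.IsIrreducible, FreeGroupDetection.isReducible_iff]
      simp only [FreeGroupDetection.isConj_iff_deckCharacter hα hp K]
      push Not
      exact Iff.rfl
  -- In rank at most one there are no free factor systems and every automorphism squares to the
  -- identity, so both sides of each equivalence hold without any separation by characters.
  · have : Subsingleton (Fin n) := Fin.subsingleton_iff_le_one.mpr (by omega)
    have hψ := FreeGroupDetection.sq_eq_one_of_subsingleton ψ
    have hfin : IsOfFinOrder ψ := isOfFinOrder_iff_pow_eq_one.mpr ⟨2, two_pos, hψ⟩
    refine ⟨iff_of_true hfin ((FreeGroupDetection.autRep K).isOfFinOrder hfin),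
      iff_of_true ((QuotientGroup.mk' _).isOfFinOrder hfin) ⟨2, two_pos, fun χ _ g => by rw [hψ]; rfl⟩,
      fun h => absurd h hn, iff_of_true ?_ fun k A hA =>
        absurd (FreeGroupDetection.two_le_of_isFreeFactorSystem hA) hn⟩
    rw [FreeGroupDetection.IsIrreducible, FreeGroupDetection.isReducible_iff]
    rintro ⟨k, A, hA, -⟩
    exact hn (FreeGroupDetection.two_le_of_isFreeFactorSystem hA)
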